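/- Let $n\ge 1$ be an integer, let $p,q\in\mathbb R$ with $p^2+q^2=1$, and let $h=h(x,y;p,q)$ be an arbitrary complex-valued function of real variables (no regularity is assumed). For $m\ge 0$ and $\ell\ge 1$ put $$\zeta_m(h)=\frac{p^2(x^2-h)^{m+1}+q^2(y^2-h)^{m+1}-(1-h)^{m+1}}{m+1},\qquad \hat F(\ell,h;z)=(-h)^{\ell-1}\,{}_2F_1\!\left(\tfrac12,1-\ell;\tfrac32;\tfrac{z^2}{h}\right),$$ where $\hat F(\ell,h;z)$, a polynomial in $h$ and $z$, is given at $h=0$ its limit value $z^{2(\ell-1)}/(2\ell-1)$. Let $S^{(h)}_n(z)=S^{(h)}_n(x,y;p,q\mid z)$ be the bordered Hankel determinant $$S^{(h)}_n(z)=\det\begin{pmatrix}\big(\zeta_{k+\ell-2}(h)\big)_{1\le k,\ell\le n} & \big(\hat F(k,h;z)\big)_{1\le k\le n}\\[2pt] \big((1-h)^{\ell-1}\big)_{1\le \ell\le n} & 0\end{pmatrix}$$ of order $n+1$, evaluated at $h=h(x,y;p,q)$, and let $$\xi_n(x,y)=\frac{p\,x\,S^{(h)}_n(x)-i\,q\,y\,S^{(h)}_n(y)}{S^{(h)}_n(1)}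 .$$ (1) For all real $x,y$ and all complex $z$, and for every $h$, $S^{(h)}_n(z)$ is, up to normalisation, the determinant of Vein and that of Yamazaki and Hori: $$z\,S^{(h)}_n(z)=G_n(z),\qquad S^{(h)}_n(z)=-S_n(z).$$ Here, with $\psi_m=\frac1{m+1}\left[p^2x^{2(m+1)}+q^2y^{2(m+1)}-1\right]$, $G_n(z)$ is the determinant of order $n+1$ with main block $(\psi_{k+\ell-2})_{1\le k,\ell\le n}$, last column $z^{2k-1}/(2k-1)$ ($1\le k\le n$), last row $1,\dots,1$ and corner entry $0$. With $\phi_m=\frac1{m+1}\left[p^2(x^2-1)^{m+1}+q^2(y^2-1)^{m+1}\right]$, $S_n(z)$ is the determinant of the $n\times n$ matrix $(\phi_{k+\ell-2})$ with its first column replaced by $P_1(z),\dots,P_n(z)$, where $P_k(z)=\frac1{e_k}\sum_{l=1}^k d_l(z^2-1)^{l-1}$, $d_l=(-1)^{l-1}\frac{\Gamma(l-1/2)}{\Gamma(1/2)(l-1)!}$ and $e_l=(-1)^{l-1}\frac{\Gamma(l+1/2)}{\Gamma(3/2)(l-1)!}$. (2) The set of $(x,y)\in\mathbb R^2$ with $S^{(h)}_n(1)\ne0$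 is open and dense, and on it $\xi_n$ is twice continuously differentiable and solves the Ernst equation $(\xi\xi^*-1)\nabla^2\xi=2\xi^*(\nabla\xi)^2$ written in prolate spheroidal coordinates: $$(\xi\xi^*-1)\Big[\partial_x\big((x^2-1)\partial_x\xi\big)+\partial_y\big((1-y^2)\partial_y\xi\big)\Big]=2\xi^*\Big[(x^2-1)(\partial_x\xi)^2+(1-y^2)(\partial_y\xi)^2\Big].$$ (3) Let $\kappa>0$ and let $(x,y)$, $x>1$, $|y|<1$, be the prolate spheroidal coordinates of the point with cylindrical coordinates $r=\kappa\sqrt{(x^2-1)(1-y^2)}$, $z=\kappa xy$. Then on the open set of $(r,z)$ with $r>0$ at which $S^{(h)}_n(1)\neq 0$, $\xi_n$ as a function of $(r,z)$ is twice continuously differentiable and solves the Ernst equation $$(\xi\xi^*-1)\Big(\partial_r^2\xi+\tfrac1r\partial_r\xi+\partial_z^2\xi\Big)=2\xi^*\Big((\partial_r\xi)^2+(\partial_z\xi)^2\Big).$$ -/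

import Mathlib

open scoped ComplexConjugate

noncomputable section

namespace Ernst

/-! ### The Ernst equation -/

/-- `ξ = ξ(r, z)` is a (classical, twice continuously differentiable) solution on the open set `U`
of the Ernst equation `(ξ ξ* - 1) ∇²ξ = 2 ξ* (∇ξ)²`, where `(r, z)` are the cylindrical coordinates
of flat three-dimensional space and `ξ` does not depend on the angle:
`∇²ξ = ξ_rr + ξ_r / r + ξ_zz`, `(∇ξ)² = ξ_r² + ξ_z²`. -/
def IsSolutionOn (U : Set (ℝ × ℝ)) (ξ : ℝ → ℝ → ℂ) : Prop :=
  IsOpen U ∧ ContDiffOn ℝ 2 (Function.uncurry ξ) U ∧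
    ∀ r z : ℝ, (r, z) ∈ U →
      (ξ r z * conj (ξ r z) - 1) *
          (deriv (deriv fun s => ξ s z) r + (1 / (r : ℂ)) * deriv (fun s => ξ s z) r
            + deriv (deriv fun s => ξ r s) z) =
        2 * conj (ξ r z) * (deriv (fun s => ξ s z) r ^ 2 + deriv (fun s => ξ r s) z ^ 2)

/-- The Ernst equation for `ξ = ξ(x, y)` in prolate spheroidal coordinates, on the open set `U`:
there `κ² (x² - y²) ∇²ξ = ∂_x ((x² - 1) ξ_x) + ∂_y ((1 - y²) ξ_y)` and
`κ² (x² - y²) (∇ξ)² = (x² - 1) ξ_x² + (1 - y²) ξ_y²`; the common factor is cancelled. -/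
def IsProlateSolutionOn (U : Set (ℝ × ℝ)) (ξ : ℝ → ℝ → ℂ) : Prop :=
  IsOpen U ∧ ContDiffOn ℝ 2 (Function.uncurry ξ) U ∧
    ∀ x y : ℝ, (x, y) ∈ U →
      (ξ x y * conj (ξ x y) - 1) *
          (deriv (fun s : ℝ => ((s : ℂ) ^ 2 - 1) * deriv (fun t => ξ t y) s) x
            + deriv (fun s : ℝ => (1 - (s : ℂ) ^ 2) * deriv (fun t => ξ x t) s) y) =
        2 * conj (ξ x y) *
          (((x : ℂ) ^ 2 - 1) * deriv (fun s => ξ s y) x ^ 2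
            + (1 - (y : ℂ) ^ 2) * deriv (fun s => ξ x s) y ^ 2)

/-- The prolate coordinate `x > 1` as a function of `r > 0` and `z`. -/
def prolateX (κ r z : ℝ) : ℝ :=
  (√(r ^ 2 + (z + κ) ^ 2) + √(r ^ 2 + (z - κ) ^ 2)) / (2 * κ)

/-- The prolate coordinate `y ∈ (-1, 1)` as a function of `r > 0` and `z`. -/
def prolateY (κ r z : ℝ) : ℝ :=
  (√(r ^ 2 + (z + κ) ^ 2) - √(r ^ 2 + (z - κ) ^ 2)) / (2 * κ)

/-- `prolateX`, `prolateY` satisfy `r = κ √((x² - 1)(1 - y²))`, `z = κ x y`. -/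
theorem prolate_spec {κ r : ℝ} (hκ : 0 < κ) (hr : 0 < r) (z : ℝ) :
    1 < prolateX κ r z ∧ |prolateY κ r z| < 1 ∧
      r = κ * √((prolateX κ r z ^ 2 - 1) * (1 - prolateY κ r z ^ 2)) ∧
      z = κ * prolateX κ r z * prolateY κ r z := by
  have ha := Real.sq_sqrt (show 0 ≤ r ^ 2 + (z + κ) ^ 2 by positivity)
  have hb := Real.sq_sqrt (show 0 ≤ r ^ 2 + (z - κ) ^ 2 by positivity)
  have ha0 := Real.sqrt_nonneg (r ^ 2 + (z + κ) ^ 2)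
  have hb0 := Real.sqrt_nonneg (r ^ 2 + (z - κ) ^ 2)
  have hr2 : 0 < r ^ 2 := by positivity
  have ha1 : |z + κ| < √(r ^ 2 + (z + κ) ^ 2) := by
    rw [← Real.sqrt_sq_eq_abs]
    exact Real.sqrt_lt_sqrt (sq_nonneg _) (by linarith)
  have hb1 : |z - κ| < √(r ^ 2 + (z - κ) ^ 2) := by
    rw [← Real.sqrt_sq_eq_abs]
    exact Real.sqrt_lt_sqrt (sq_nonneg _) (by linarith)
  unfold prolateX prolateY
  generalize √(r ^ 2 + (z + κ) ^ 2) = a at *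
  generalize √(r ^ 2 + (z - κ) ^ 2) = b at *
  rw [abs_lt] at ha1 hb1
  have h1 : 2 * κ < a + b := by linarith
  have hX : 1 < (a + b) / (2 * κ) := by rw [lt_div_iff₀ (by positivity)]; linarith
  have hz : a ^ 2 - b ^ 2 = 4 * κ * z := by rw [ha, hb]; ring
  have key : (((a + b) / (2 * κ)) ^ 2 - 1) * (1 - ((a - b) / (2 * κ)) ^ 2) = (r / κ) ^ 2 := by
    have e1 : (((a + b) / (2 * κ)) ^ 2 - 1) * (1 - ((a - b) / (2 * κ)) ^ 2) =
        (a ^ 2 + b ^ 2) / (2 * κ ^ 2) - ((a ^ 2 - b ^ 2) / (4 * κ ^ 2)) ^ 2 - 1 := by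
      field_simp
      ring
    rw [e1, hz, ha, hb]
    field_simp
    ring
  refine ⟨hX, ?_, ?_, ?_⟩
  · have hpos : 0 < ((a + b) / (2 * κ)) ^ 2 - 1 := by nlinarith
    have hk : 0 < (((a + b) / (2 * κ)) ^ 2 - 1) * (1 - ((a - b) / (2 * κ)) ^ 2) := by
      rw [key]; positivity
    have := pos_of_mul_pos_right hk hpos.le
    rw [← sq_lt_one_iff_abs_lt_one]
    linarith
  · rw [key, Real.sqrt_sq (by positivity)]
    field_simp
  · have : κ * ((a + b) / (2 * κ)) * ((a - b) / (2 * κ)) = (a ^ 2 - b ^ 2) / (4 * κ) := by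
      field_simp
      ring
    rw [this, hz]
    field_simp

/-- Conversely, `prolateX`, `prolateY` invert `(x, y) ↦ (κ √((x² - 1)(1 - y²)), κ x y)`. -/
theorem prolate_leftInverse {κ x y : ℝ} (hκ : 0 < κ) (hx : 1 < x) (hy : |y| < 1) :
    prolateX κ (κ * √((x ^ 2 - 1) * (1 - y ^ 2))) (κ * x * y) = x ∧
      prolateY κ (κ * √((x ^ 2 - 1) * (1 - y ^ 2))) (κ * x * y) = y := by
  have hy2 : y ^ 2 < 1 := (sq_lt_one_iff_abs_lt_one y).2 hy
  rw [abs_lt] at hy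
  have h0 : 0 ≤ (x ^ 2 - 1) * (1 - y ^ 2) := mul_nonneg (by nlinarith) (by linarith)
  have e1 : (κ * √((x ^ 2 - 1) * (1 - y ^ 2))) ^ 2 + (κ * x * y + κ) ^ 2 = (κ * (x + y)) ^ 2 := by
    rw [mul_pow, Real.sq_sqrt h0]; ring
  have e2 : (κ * √((x ^ 2 - 1) * (1 - y ^ 2))) ^ 2 + (κ * x * y - κ) ^ 2 = (κ * (x - y)) ^ 2 := by
    rw [mul_pow, Real.sq_sqrt h0]; ring
  unfold prolateX prolateY
  rw [e1, e2, Real.sqrt_sq (mul_nonneg hκ.le (by linarith)),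
    Real.sqrt_sq (mul_nonneg hκ.le (by linarith))]
  constructor <;> field_simp <;> ring

/-! ### The `h`-dependent bordered Hankel determinant -/

/-- `ζ_m(h) = [p² (x² - h)^{m+1} + q² (y² - h)^{m+1} - (1 - h)^{m+1}] / (m + 1)`. -/
def zeta (x y p q : ℝ) (h : ℂ) (m : ℕ) : ℂ :=
  (1 / ((m : ℂ) + 1)) *
    ((p : ℂ) ^ 2 * ((x : ℂ) ^ 2 - h) ^ (m + 1) + (q : ℂ) ^ 2 * ((y : ℂ) ^ 2 - h) ^ (m + 1)
      - (1 - h) ^ (m + 1))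

/-- `F̂(ℓ, h; z) = (-h)^{ℓ-1} ₂F₁(1/2, 1 - ℓ; 3/2; z²/h)` for `ℓ ≥ 1`. This is a polynomial in
`h` and `z`; at `h = 0` it is given its limit value `z^{2(ℓ-1)} / (2ℓ - 1)`. -/
def Fhat (ℓ : ℕ) (h z : ℂ) : ℂ :=
  if h = 0 then z ^ (2 * (ℓ - 1)) / (2 * (ℓ : ℂ) - 1)
  else (-h) ^ (ℓ - 1) * ₂F₁ (1 / 2 : ℂ) (1 - (ℓ : ℂ)) (3 / 2 : ℂ) (z ^ 2 / h)

/-- The explicit polynomial form of `F̂(m + 1, h; z)`, valid also at `h = 0`. -/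
theorem Fhat_eq_sum (m : ℕ) (h z : ℂ) :
    Fhat (m + 1) h z = ∑ j ∈ Finset.range (m + 1),
      (-1) ^ (m + j) * (m.choose j : ℂ) * h ^ (m - j) * (z ^ (2 * j) / (2 * (j : ℂ) + 1)) := by
  have half : ∀ j : ℕ, (ascPochhammer ℂ j).eval (3/2:ℂ) ≠ 0 := by
    intro j
    rw [Ne, ascPochhammer_eval_eq_zero_iff]
    rintro ⟨k, -, hk⟩
    have : ((2 * k + 3 : ℕ) : ℂ) = 0 := by push_cast; rw [hk]; ring
    norm_cast at this
  have ratio : ∀ j : ℕ, (ascPochhammer ℂ j).eval (1/2:ℂ) * (2 * (j:ℂ) + 1) = (ascPochhammer ℂ j).eval (3/2:ℂ) := by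
    intro j
    induction j with
    | zero => simp
    | succ j ih =>
      rw [ascPochhammer_succ_eval, ascPochhammer_succ_eval, ← ih]; push_cast; ring
  have odd : ∀ j : ℕ, (2 * (j:ℂ) + 1) ≠ 0 := fun j => by
    exact_mod_cast Nat.succ_ne_zero (2 * j)
  unfold Fhat
  split_ifs with h0
  · subst h0
    rw [Finset.sum_range_succ, Finset.sum_eq_zero]
    · simp only [← two_mul, Nat.add_sub_cancel]
      push_cast
      rw [show (2 * ((m : ℂ) + 1) - 1) = 2 * (m : ℂ) + 1 by ring]
      simp
    · intro j hj
      rw [zero_pow (by have := Finset.mem_range.1 hj; omega)]; simp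
  · rw [ordinaryHypergeometric_eq_tsum]
    simp only [smul_eq_mul]
    rw [tsum_eq_sum (s := Finset.range (m+1))]
    · rw [Finset.mul_sum]
      refine Finset.sum_congr rfl fun j hj => ?_
      have hjm : j ≤ m := by have := Finset.mem_range.1 hj; omega
      have hb : (ascPochhammer ℂ j).eval (1 - ((m+1:ℕ):ℂ)) = (-1)^j * (j.factorial * m.choose j : ℂ) := by
        have : (1 - ((m+1:ℕ):ℂ)) = -(m:ℂ) := by push_cast; ring
        rw [this, ascPochhammer_eval_neg_eq_descPochhammer, descPochhammer_eval_eq_descFactorial, Nat.descFactorial_eq_factorial_mul_choose]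
        push_cast; ring
      rw [hb, ← ratio j]
      have h1 : (ascPochhammer ℂ j).eval (1/2:ℂ) ≠ 0 := fun e => half j (by rw [← ratio, e, zero_mul])
      have h2 : (j.factorial : ℂ) ≠ 0 := by exact_mod_cast j.factorial_ne_zero
      have h3 : h ^ m = h ^ (m - j) * h ^ j := by rw [← pow_add]; congr 1; omega
      have := odd j
      simp only [Nat.add_sub_cancel]
      rw [neg_pow, h3, div_pow, pow_add, pow_mul]
      field_simp
    · intro j hj
      have hjm : m < j := by have := Finset.mem_range.not.1 hj; omega
      have : (ascPochhammer ℂ j).eval (1 - ((m+1:ℕ):ℂ)) = 0 :=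
        (ascPochhammer_eval_eq_zero_iff _ _).2 ⟨m, hjm, by push_cast; ring⟩
      rw [this]; simp

/-- The bordered Hankel determinant `S^{(h)}_n(x, y; p, q | z)` of order `n + 1`:
main block `ζ_{k+l-2}(h)`, last column `F̂(k, h; z)`, last row `(1 - h)^{l-1}`, corner `0`
(`k, l = 1, …, n`; the indices in the code start at `0`). -/
def detS (n : ℕ) (x y p q : ℝ) (h z : ℂ) : ℂ :=
  (Matrix.fromBlocks
    (Matrix.of fun i j : Fin n => zeta x y p q h ((i : ℕ) + (j : ℕ)))
    (Matrix.of fun (i : Fin n) (_ : Unit) => Fhat ((i : ℕ) + 1) h z)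
    (Matrix.of fun (_ : Unit) (j : Fin n) => (1 - h) ^ (j : ℕ))
    (0 : Matrix Unit Unit ℂ)).det

/-- The Ernst potential
`ξ_n = (p x S^{(h)}_n(x) - i q y S^{(h)}_n(y)) / S^{(h)}_n(1)`, `h = h(x, y; p, q)`. -/
def potential (n : ℕ) (p q : ℝ) (h : ℝ → ℝ → ℝ → ℝ → ℂ) (x y : ℝ) : ℂ :=
  ((p : ℂ) * x * detS n x y p q (h x y p q) x
      - Complex.I * q * y * detS n x y p q (h x y p q) y) /
    detS n x y p q (h x y p q) 1

/-! ### The determinants of Vein and of Yamazaki and Hori -/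

/-- `ψ_m = [p² x^{2(m+1)} + q² y^{2(m+1)} - 1] / (m + 1)`. -/
def psi (x y p q : ℝ) (m : ℕ) : ℂ :=
  (1 / ((m : ℂ) + 1)) *
    ((p : ℂ) ^ 2 * ((x : ℂ) ^ 2) ^ (m + 1) + (q : ℂ) ^ 2 * ((y : ℂ) ^ 2) ^ (m + 1) - 1)

/-- Vein's bordered determinant `G_n(x, y; p, q | z)`: main block `ψ_{k+l-2}`, last column
`z^{2k-1} / (2k - 1)`, last row `1`, corner `0`. -/
def detVein (n : ℕ) (x y p q : ℝ) (z : ℂ) : ℂ :=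
  (Matrix.fromBlocks
    (Matrix.of fun i j : Fin n => psi x y p q ((i : ℕ) + (j : ℕ)))
    (Matrix.of fun (i : Fin n) (_ : Unit) => z ^ (2 * (i : ℕ) + 1) / (2 * ((i : ℕ) : ℂ) + 1))
    (Matrix.of fun (_ : Unit) (_ : Fin n) => (1 : ℂ))
    (0 : Matrix Unit Unit ℂ)).det

/-- `φ_m = [p² (x² - 1)^{m+1} + q² (y² - 1)^{m+1}] / (m + 1)`. -/
def phi (x y p q : ℝ) (m : ℕ) : ℂ :=
  (1 / ((m : ℂ) + 1)) *
    ((p : ℂ) ^ 2 * ((x : ℂ) ^ 2 - 1) ^ (m + 1) + (q : ℂ) ^ 2 * ((y : ℂ) ^ 2 - 1) ^ (m + 1))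

/-- `d_l = (-1)^{l-1} Γ(l - 1/2) / (Γ(1/2) (l - 1)!)`, `l ≥ 1`. -/
def coeffD (l : ℕ) : ℝ :=
  (-1) ^ (l - 1) * Real.Gamma ((l : ℝ) - 1 / 2) / (Real.Gamma (1 / 2) * ((l - 1).factorial : ℝ))

/-- `e_l = (-1)^{l-1} Γ(l + 1/2) / (Γ(3/2) (l - 1)!)`, `l ≥ 1`. -/
def coeffE (l : ℕ) : ℝ :=
  (-1) ^ (l - 1) * Real.Gamma ((l : ℝ) + 1 / 2) / (Real.Gamma (3 / 2) * ((l - 1).factorial : ℝ))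

/-- `P_k(z) = (1 / e_k) ∑_{l=1}^k d_l (z² - 1)^{l-1}`. -/
def polyP (k : ℕ) (z : ℂ) : ℂ :=
  (1 / (coeffE k : ℂ)) * ∑ l ∈ Finset.Icc 1 k, (coeffD l : ℂ) * (z ^ 2 - 1) ^ (l - 1)

/-- The determinant `S_n(x, y; p, q | z)` of Yamazaki and Hori: the Hankel matrix `φ_{k+l-2}` of
order `n` with its first column replaced by `P_1(z), …, P_n(z)`. -/
def detYH (n : ℕ) (x y p q : ℝ) (z : ℂ) : ℂ :=
  (Matrix.of fun i j : Fin n =>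
    if (j : ℕ) = 0 then polyP ((i : ℕ) + 1) z else phi x y p q ((i : ℕ) + (j : ℕ))).det

end Ernst

end

/-!
The determinants have a meaning in terms of orthogonal polynomials. Since `p² + q² = 1`, the number
`ζ_m(h)` is the moment `∫ (t - h)^m dμ` of the signed measure `μ` with density `p²` on `[1, x²]` and
`q²` on `[1, y²]`. Changing `h` is a unitriangular change of the basis of polynomials, which gives the
independence of `h` (`Ernst.detS_eq_detS_zero`); `h = 0` is Vein's determinant, and `h = 1` that of
Yamazaki and Hori, the entries of whose first column obey the recurrence of `∫₀^z (s² - 1)^m ds`.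

Let `A` be the Hankel matrix of the moments for `h = 0` and `K` the reproducing kernel of the
polynomials of degree `< n`. By the Schur complement, `z S(z) = -det A · g(z)` with
`g(z) = ∫₀^z K(1, s²) ds`, so that `ξ = (p g(x) - i q g(y)) / g(1)` wherever `det A ≠ 0`. More generally
let `γ_c(z) = ∫₀^z K(c², s²) ds` for the three end points `c = 1, x, y`. Three Lyapunov equations
`X A + A Xᵀ = ∑ cₖ rₖ rₖᵀ`, turned into statements on `A⁻¹` by `Ernst.bil_of_lyapunov`, carry the proof:

* integration by parts gives `∑ mₖ γ_a(cₖ) γ_b(cₖ)`, with the jumps `m = -1, p², q²` of the density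
  (`Ernst.gam_orthogonality`); so `(1 + 2 g(1), 2 g(x), 2 g(y))` is a unit vector of Lorentzian
  signature, and the vectors `e_c - 2 m_c c γ_c` form an orthogonal frame that contains it;
* scaling of `t` gives the derivative of the frame (`Ernst.gam_euler`, `Ernst.hasDerivAt_mul_gam`);
* dilations about `t = 1` give
  `∂_x ((x² - 1) K(1, x²)) = 2 x q² (y² - 1) K(1, y²) K(x², y²)` (`Ernst.hasDerivAt_mul_kap`).

Together they say that the unit vector is a harmonic map, and `ξ` is its stereographic projection, for
which the harmonic map equation is the Ernst equation (`Ernst.stereographic_ernst`). The points with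
`det A ≠ 0` are dense: on the line `x = y → ∞` the suitably rescaled determinants tend to those built
from the Hilbert matrix, which is positive definite. Both sides of the equation being continuous
where `S(1) ≠ 0`, it holds there too. The cylindrical form follows by the chain rule
(`Ernst.IsProlateSolutionOn.isSolutionOn`).
-/

namespace Ernst

open Matrix

/-! ### Independence of `h` -/

/-- The lower unitriangular matrix of the substitution `t ↦ t - h` on the monomials `t ^ i`. -/
def shiftMatrix (n : ℕ) (h : ℂ) : Matrix (Fin n) (Fin n) ℂ :=
  Matrix.of fun i j => ((i : ℕ).choose (j : ℕ) : ℂ) * (-h) ^ ((i : ℕ) - (j : ℕ))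

theorem shiftMatrix_det (n : ℕ) (h : ℂ) : (shiftMatrix n h).det = 1 := by
  rw [Matrix.det_of_isLowerTriangular]
  · simp [shiftMatrix]
  · intro i j hij
    have : (i : ℕ) < j := hij
    simp [shiftMatrix, Nat.choose_eq_zero_of_lt this]

theorem sum_shiftMatrix (n : ℕ) (h : ℂ) (i : Fin n) (f : ℕ → ℂ) :
    ∑ j : Fin n, shiftMatrix n h i j * f j =
      ∑ j ∈ Finset.range ((i : ℕ) + 1), ((i : ℕ).choose j : ℂ) * (-h) ^ ((i : ℕ) - j) * f j := by
  simp only [shiftMatrix, Matrix.of_apply]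
  rw [Fin.sum_univ_eq_sum_range
    (fun j => ((i : ℕ).choose j : ℂ) * (-h) ^ ((i : ℕ) - j) * f j) n]
  refine (Finset.sum_subset (Finset.range_subset_range.2 i.2) fun j _ hj => ?_).symm
  rw [Finset.mem_range, not_lt] at hj
  simp [Nat.choose_eq_zero_of_lt (show (i : ℕ) < j from hj)]

theorem sum_shiftMatrix_pow (n : ℕ) (h t : ℂ) (i : Fin n) :
    ∑ j : Fin n, shiftMatrix n h i j * t ^ (j : ℕ) = (t - h) ^ (i : ℕ) := by
  rw [sum_shiftMatrix n h i (fun j => t ^ j), sub_eq_add_neg, add_pow]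
  exact Finset.sum_congr rfl fun j _ => by ring

/-- The integral of a shifted power; the shift `h` may be complex. -/
theorem integral_sub_pow (a : ℝ) (h : ℂ) (m : ℕ) :
    ∫ t in (1 : ℝ)..a, ((t : ℂ) - h) ^ m =
      1 / ((m : ℂ) + 1) * (((a : ℂ) - h) ^ (m + 1) - (1 - h) ^ (m + 1)) := by
  have hm : ((m : ℂ) + 1) ≠ 0 := by exact_mod_cast m.succ_ne_zero
  rw [intervalIntegral.integral_eq_sub_of_hasDerivAt
    (f := fun t : ℝ => 1 / ((m : ℂ) + 1) * ((t : ℂ) - h) ^ (m + 1))]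
  · push_cast; ring
  · intro t _
    have h1 : HasDerivAt (fun s : ℂ => 1 / ((m : ℂ) + 1) * (s - h) ^ (m + 1))
        (1 / ((m : ℂ) + 1) * (((m + 1 : ℕ) : ℂ) * ((t : ℂ) - h) ^ m * 1)) (t : ℂ) :=
      (((hasDerivAt_id (t : ℂ)).sub_const h).pow (m + 1)).const_mul _
    refine h1.comp_ofReal.congr_deriv ?_
    push_cast
    field_simp
  · exact Continuous.intervalIntegrable (by fun_prop) _ _

/-- `ζ_m(h)` is the `m`-th moment about `h` of the measure with density `p²` on `[1, x²]` and
`q²` on `[1, y²]`; the constants match because `p² + q² = 1`. -/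
theorem zeta_eq_integral {p q : ℝ} (hpq : p ^ 2 + q ^ 2 = 1) (x y : ℝ) (h : ℂ) (m : ℕ) :
    zeta x y p q h m = (p : ℂ) ^ 2 * (∫ t in (1 : ℝ)..(x ^ 2), ((t : ℂ) - h) ^ m)
      + (q : ℂ) ^ 2 * ∫ t in (1 : ℝ)..(y ^ 2), ((t : ℂ) - h) ^ m := by
  have hc : (p : ℂ) ^ 2 + (q : ℂ) ^ 2 = 1 := by exact_mod_cast hpq
  rw [integral_sub_pow, integral_sub_pow, zeta]
  push_cast
  linear_combination (1 / ((m : ℂ) + 1) * (1 - h) ^ (m + 1)) * hc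

theorem integral_shift (n : ℕ) (h : ℂ) (a : ℝ) (i j : Fin n) :
    ∫ t in (1 : ℝ)..a, ((t : ℂ) - h) ^ ((i : ℕ) + (j : ℕ)) =
      ∑ k : Fin n, ∑ l : Fin n, shiftMatrix n h i k * shiftMatrix n h j l *
        ∫ t in (1 : ℝ)..a, ((t : ℂ) - 0) ^ ((k : ℕ) + (l : ℕ)) := by
  have hi : ∀ f : ℝ → ℂ, Continuous f → IntervalIntegrable f MeasureTheory.volume 1 a :=
    fun f hf => hf.intervalIntegrable _ _
  simp only [← intervalIntegral.integral_const_mul]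
  have h1 : ∀ k : Fin n, ∑ l : Fin n, ∫ t in (1 : ℝ)..a, shiftMatrix n h i k *
      shiftMatrix n h j l * ((t : ℂ) - 0) ^ ((k : ℕ) + (l : ℕ)) =
      ∫ t in (1 : ℝ)..a, ∑ l : Fin n, shiftMatrix n h i k *
        shiftMatrix n h j l * ((t : ℂ) - 0) ^ ((k : ℕ) + (l : ℕ)) := fun k =>
    (intervalIntegral.integral_finsetSum fun l _ => hi _ (by fun_prop)).symm
  simp only [h1]
  rw [← intervalIntegral.integral_finsetSum fun l _ => hi _ (by fun_prop)]
  refine intervalIntegral.integral_congr fun t _ => ?_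
  simp only [pow_add, sub_zero]
  rw [← sum_shiftMatrix_pow n h t i, ← sum_shiftMatrix_pow n h t j, Finset.sum_mul_sum]
  exact Finset.sum_congr rfl fun k _ => Finset.sum_congr rfl fun l _ => by ring

theorem zeta_shift {p q : ℝ} (hpq : p ^ 2 + q ^ 2 = 1) (x y : ℝ) (h : ℂ) (n : ℕ) (i j : Fin n) :
    zeta x y p q h ((i : ℕ) + (j : ℕ)) = ∑ k : Fin n, ∑ l : Fin n,
      shiftMatrix n h i k * shiftMatrix n h j l * zeta x y p q 0 ((k : ℕ) + (l : ℕ)) := by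
  simp only [zeta_eq_integral hpq]
  rw [integral_shift n, integral_shift n, Finset.mul_sum, Finset.mul_sum,
    ← Finset.sum_add_distrib]
  refine Finset.sum_congr rfl fun k _ => ?_
  rw [Finset.mul_sum, Finset.mul_sum, ← Finset.sum_add_distrib]
  exact Finset.sum_congr rfl fun l _ => by ring

theorem Fhat_zero (m : ℕ) (z : ℂ) : Fhat (m + 1) 0 z = z ^ (2 * m) / (2 * (m : ℂ) + 1) := by
  rw [Fhat, if_pos rfl]
  simp only [Nat.add_sub_cancel]
  push_cast
  ring

theorem Fhat_shift (n : ℕ) (h z : ℂ) (i : Fin n) :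
    Fhat ((i : ℕ) + 1) h z = ∑ j : Fin n, shiftMatrix n h i j * Fhat ((j : ℕ) + 1) 0 z := by
  rw [sum_shiftMatrix n h i (fun j => Fhat (j + 1) 0 z), Fhat_eq_sum]
  refine Finset.sum_congr rfl fun j hj => ?_
  have hji : j ≤ (i : ℕ) := by have := Finset.mem_range.1 hj; omega
  have : (-1 : ℂ) ^ ((i : ℕ) + j) = (-1) ^ ((i : ℕ) - j) := by
    rw [show (i : ℕ) + j = ((i : ℕ) - j) + 2 * j by omega, pow_add, pow_mul]; simp
  rw [Fhat_zero, this, neg_pow h]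
  ring

/-- The bordered determinant does not depend on `h`: changing `h` amounts to a unitriangular
change of the basis of polynomials that the moment matrix refers to. -/
theorem detS_eq_detS_zero {p q : ℝ} (hpq : p ^ 2 + q ^ 2 = 1) (n : ℕ) (x y : ℝ) (h z : ℂ) :
    detS n x y p q h z = detS n x y p q 0 z := by
  have key : (Matrix.fromBlocks
      (Matrix.of fun i j : Fin n => zeta x y p q h ((i : ℕ) + (j : ℕ)))
      (Matrix.of fun (i : Fin n) (_ : Unit) => Fhat ((i : ℕ) + 1) h z)
      (Matrix.of fun (_ : Unit) (j : Fin n) => (1 - h) ^ (j : ℕ))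
      (0 : Matrix Unit Unit ℂ)) =
    Matrix.fromBlocks (shiftMatrix n h) 0 0 1 * (Matrix.fromBlocks
      (Matrix.of fun i j : Fin n => zeta x y p q 0 ((i : ℕ) + (j : ℕ)))
      (Matrix.of fun (i : Fin n) (_ : Unit) => Fhat ((i : ℕ) + 1) 0 z)
      (Matrix.of fun (_ : Unit) (j : Fin n) => (1 - 0) ^ (j : ℕ))
      (0 : Matrix Unit Unit ℂ)) * Matrix.fromBlocks (shiftMatrix n h)ᵀ 0 0 1 := by
    rw [Matrix.fromBlocks_multiply, Matrix.fromBlocks_multiply]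
    congr 1
    · ext i j
      simp only [Matrix.of_apply, Matrix.mul_apply, Matrix.transpose_apply, Matrix.zero_mul,
        Matrix.mul_zero, add_zero]
      rw [zeta_shift hpq x y h n i j, Finset.sum_comm]
      refine Finset.sum_congr rfl fun l _ => ?_
      rw [Finset.sum_mul]
      exact Finset.sum_congr rfl fun k _ => by ring
    · ext i j
      simp [Matrix.mul_apply, Fhat_shift n h z i]
    · ext i j
      simp [Matrix.mul_apply, ← sum_shiftMatrix_pow n h 1 j]
    · simp
  rw [detS, key, Matrix.det_mul, Matrix.det_mul, Matrix.det_fromBlocks_zero₂₁,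
    Matrix.det_fromBlocks_zero₂₁, Matrix.det_transpose, shiftMatrix_det, Matrix.det_one]
  simp [detS]

/-! ### The determinants of Vein and of Yamazaki and Hori -/

theorem mul_detS_zero (n : ℕ) (x y p q : ℝ) (z : ℂ) :
    z * detS n x y p q 0 z = detVein n x y p q z := by
  have key : (Matrix.fromBlocks
      (Matrix.of fun i j : Fin n => psi x y p q ((i : ℕ) + (j : ℕ)))
      (Matrix.of fun (i : Fin n) (_ : Unit) => z ^ (2 * (i : ℕ) + 1) / (2 * ((i : ℕ) : ℂ) + 1))
      (Matrix.of fun (_ : Unit) (_ : Fin n) => (1 : ℂ))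
      (0 : Matrix Unit Unit ℂ)) = (Matrix.fromBlocks
      (Matrix.of fun i j : Fin n => zeta x y p q 0 ((i : ℕ) + (j : ℕ)))
      (Matrix.of fun (i : Fin n) (_ : Unit) => Fhat ((i : ℕ) + 1) 0 z)
      (Matrix.of fun (_ : Unit) (j : Fin n) => (1 - 0) ^ (j : ℕ))
      (0 : Matrix Unit Unit ℂ)) *
        Matrix.fromBlocks 1 0 0 (Matrix.diagonal fun _ : Unit => z) := by
    rw [Matrix.fromBlocks_multiply]
    congr 1
    · ext i j; simp [psi, zeta]
    · ext i j; simp [Fhat_zero]; ring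
    · ext i j; simp
    · ext i j; simp
  rw [detVein, key, Matrix.det_mul, Matrix.det_fromBlocks_zero₂₁, Matrix.det_one,
    Matrix.det_diagonal]
  simp [detS, mul_comm]

theorem coeffD_ne_zero (m : ℕ) : coeffD (m + 1) ≠ 0 := by
  have h1 : Real.Gamma (((m + 1 : ℕ) : ℝ) - 1 / 2) ≠ 0 := by
    refine (Real.Gamma_pos_of_pos ?_).ne'
    have : (0 : ℝ) ≤ m := m.cast_nonneg
    push_cast; linarith
  have h2 : Real.Gamma (1 / 2) ≠ 0 := (Real.Gamma_pos_of_pos (by norm_num)).ne'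
  have h3 : (((m + 1 - 1).factorial : ℕ) : ℝ) ≠ 0 := by exact_mod_cast Nat.factorial_ne_zero _
  rw [coeffD]
  positivity

theorem coeffE_eq_mul_coeffD (m : ℕ) : coeffE (m + 1) = (2 * m + 1) * coeffD (m + 1) := by
  have h2 : Real.Gamma (1 / 2) ≠ 0 := (Real.Gamma_pos_of_pos (by norm_num)).ne'
  have h3 : Real.Gamma (3 / 2) = 1 / 2 * Real.Gamma (1 / 2) := by
    rw [← Real.Gamma_add_one (by norm_num)]; norm_num
  have h4 : Real.Gamma (((m + 1 : ℕ) : ℝ) + 1 / 2) =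
      ((m : ℝ) + 1 / 2) * Real.Gamma (((m + 1 : ℕ) : ℝ) - 1 / 2) := by
    rw [show ((m + 1 : ℕ) : ℝ) + 1 / 2 = ((m : ℝ) + 1 / 2) + 1 by push_cast; ring,
      Real.Gamma_add_one (by positivity)]
    congr 2; push_cast; ring
  have h5 : (((m + 1 - 1).factorial : ℕ) : ℝ) ≠ 0 := by exact_mod_cast Nat.factorial_ne_zero _
  rw [coeffE, coeffD, h3, h4]
  field_simp

theorem coeffE_succ (m : ℕ) : coeffE (m + 1) = -(2 * (m + 1)) * coeffD (m + 2) := by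
  rw [coeffE_eq_mul_coeffD]
  have h2 : Real.Gamma (1 / 2) ≠ 0 := (Real.Gamma_pos_of_pos (by norm_num)).ne'
  have h4 : Real.Gamma (((m + 2 : ℕ) : ℝ) - 1 / 2) =
      ((m : ℝ) + 1 / 2) * Real.Gamma (((m + 1 : ℕ) : ℝ) - 1 / 2) := by
    rw [show ((m + 2 : ℕ) : ℝ) - 1 / 2 = ((m : ℝ) + 1 / 2) + 1 by push_cast; ring,
      Real.Gamma_add_one (by positivity)]
    congr 2; push_cast; ring
  have h5 : (m.factorial : ℝ) ≠ 0 := by exact_mod_cast Nat.factorial_ne_zero _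
  have h6 : (m : ℝ) + 1 ≠ 0 := by positivity
  rw [coeffD, coeffD, h4]
  simp only [Nat.add_sub_cancel, show m + 2 - 1 = m + 1 by omega, Nat.factorial_succ]
  push_cast
  field_simp
  ring

theorem Fhat_one_at_zero (m : ℕ) : Fhat (m + 1) 1 0 = (-1) ^ m := by
  rw [Fhat_eq_sum, Finset.sum_eq_single 0]
  · simp
  · intro j _ hj; simp [hj]
  · simp

/-- `z F̂(m + 1, 1; z)` is the primitive of `(z² - 1)^m` that vanishes at `0`. -/
theorem hasDerivAt_mul_Fhat_one (m : ℕ) (z : ℂ) :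
    HasDerivAt (fun s => s * Fhat (m + 1) 1 s) ((z ^ 2 - 1) ^ m) z := by
  have e : (fun s : ℂ => s * Fhat (m + 1) 1 s) = fun s => ∑ j ∈ Finset.range (m + 1),
      ((-1) ^ (m + j) * (m.choose j : ℂ) / (2 * (j : ℂ) + 1)) * s ^ (2 * j + 1) := by
    ext s
    rw [Fhat_eq_sum, Finset.mul_sum]
    exact Finset.sum_congr rfl fun j _ => by simp; ring
  rw [e, sub_eq_add_neg, add_pow]
  refine HasDerivAt.fun_sum fun j hj => ?_
  have hjm : j ≤ m := by have := Finset.mem_range.1 hj; omega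
  have odd : (2 * (j : ℂ) + 1) ≠ 0 := by exact_mod_cast Nat.succ_ne_zero (2 * j)
  refine ((hasDerivAt_pow (2 * j + 1) z).const_mul
    ((-1) ^ (m + j) * (m.choose j : ℂ) / (2 * (j : ℂ) + 1))).congr_deriv ?_
  have : (-1 : ℂ) ^ (m + j) = (-1) ^ (m - j) := by
    rw [show m + j = (m - j) + 2 * j by omega, pow_add, pow_mul]; simp
  rw [this, ← pow_mul]
  simp only [Nat.add_sub_cancel]
  push_cast
  field_simp

theorem Fhat_one_recurrence (m : ℕ) (z : ℂ) :
    (2 * ((m : ℂ) + 1) + 1) * Fhat (m + 2) 1 z =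
      (z ^ 2 - 1) ^ (m + 1) - 2 * ((m : ℂ) + 1) * Fhat (m + 1) 1 z := by
  by_cases hz : z = 0
  · subst hz
    rw [Fhat_one_at_zero, Fhat_one_at_zero]; ring
  -- both sides, multiplied by `z`, have the same derivative and vanish at `0`
  have hd : ∀ s : ℂ, HasDerivAt (fun s : ℂ => (2 * ((m : ℂ) + 1) + 1) * (s * Fhat (m + 2) 1 s)
      - s * (s ^ 2 - 1) ^ (m + 1) + 2 * ((m : ℂ) + 1) * (s * Fhat (m + 1) 1 s)) 0 s := by
    intro s
    have h1 := (hasDerivAt_mul_Fhat_one (m + 1) s).const_mul (2 * ((m : ℂ) + 1) + 1)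
    have h2 := (hasDerivAt_mul_Fhat_one m s).const_mul (2 * ((m : ℂ) + 1))
    have h3 : HasDerivAt (fun s : ℂ => s * (s ^ 2 - 1) ^ (m + 1))
        (1 * (s ^ 2 - 1) ^ (m + 1) + s * (((m + 1 : ℕ) : ℂ) * (s ^ 2 - 1) ^ m *
          (((2 : ℕ) : ℂ) * s ^ (2 - 1) * 1))) s :=
      (hasDerivAt_id s).mul ((((hasDerivAt_id s).pow 2).sub_const 1).pow (m + 1))
    refine ((h1.sub h3).add h2).congr_deriv ?_
    push_cast
    ring
  have := is_const_of_deriv_eq_zero (fun s => (hd s).differentiableAt) (fun s => (hd s).deriv) z 0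
  simp only [zero_mul, mul_zero, sub_zero, add_zero] at this
  apply mul_left_cancel₀ hz
  linear_combination this

theorem polyP_eq_Fhat (m : ℕ) (z : ℂ) : polyP (m + 1) z = Fhat (m + 1) 1 z := by
  have hE : ∀ k, coeffE (k + 1) ≠ 0 := fun k => by
    rw [coeffE_eq_mul_coeffD]; exact mul_ne_zero (by positivity) (coeffD_ne_zero k)
  have main : ∑ l ∈ Finset.Icc 1 (m + 1), (coeffD l : ℂ) * (z ^ 2 - 1) ^ (l - 1) =
      (coeffE (m + 1) : ℂ) * Fhat (m + 1) 1 z := by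
    induction m with
    | zero =>
      have : coeffE 1 = coeffD 1 := by simpa using coeffE_eq_mul_coeffD 0
      rw [Fhat_eq_sum]
      simp [this]
    | succ m ih =>
      rw [Finset.sum_Icc_succ_top (by omega), ih, coeffE_eq_mul_coeffD (m + 1), coeffE_succ m]
      simp only [Nat.add_sub_cancel]
      push_cast
      linear_combination (-(coeffD (m + 1 + 1) : ℂ)) * Fhat_one_recurrence m z
  have : (coeffE (m + 1) : ℂ) ≠ 0 := by exact_mod_cast hE m
  rw [polyP, main]
  field_simp

/-- At `h = 1` the last row is `(1, 0, …, 0)`; exchanging the first and the last column brings in the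
minus sign. -/
theorem detS_one_eq (n : ℕ) (hn : 1 ≤ n) (x y p q : ℝ) (z : ℂ) :
    detS n x y p q 1 z = -detYH n x y p q z := by
  obtain ⟨n, rfl⟩ : ∃ k, n = k + 1 := ⟨n - 1, by omega⟩
  set M := Matrix.fromBlocks
    (Matrix.of fun i j : Fin (n + 1) => zeta x y p q 1 ((i : ℕ) + (j : ℕ)))
    (Matrix.of fun (i : Fin (n + 1)) (_ : Unit) => Fhat ((i : ℕ) + 1) 1 z)
    (Matrix.of fun (_ : Unit) (j : Fin (n + 1)) => (1 - 1 : ℂ) ^ (j : ℕ))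
    (0 : Matrix Unit Unit ℂ) with hM
  -- interchange the first and the last column
  have hp := Matrix.det_permute' (Equiv.swap (Sum.inl (0 : Fin (n + 1))) (Sum.inr ())) M
  rw [Equiv.Perm.sign_swap (by simp)] at hp
  have hS : M.submatrix id (Equiv.swap (Sum.inl (0 : Fin (n + 1))) (Sum.inr ())) =
      Matrix.fromBlocks (Matrix.of fun i j : Fin (n + 1) =>
        if (j : ℕ) = 0 then polyP ((i : ℕ) + 1) z else phi x y p q ((i : ℕ) + (j : ℕ)))
        (Matrix.of fun (i : Fin (n + 1)) (_ : Unit) => zeta x y p q 1 (i : ℕ)) 0 1 := by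
    ext i j
    rcases j with j | j
    · by_cases hj : j = 0
      · subst hj
        rcases i with i | i <;> simp [hM, polyP_eq_Fhat]
      · have h1 : (Sum.inl j : Fin (n + 1) ⊕ Unit) ≠ Sum.inl 0 := by simpa using hj
        have hj' : (j : ℕ) ≠ 0 := fun e => hj (Fin.ext e)
        rw [Matrix.submatrix_apply, Equiv.swap_apply_of_ne_of_ne h1 (by simp)]
        rcases i with i | i <;> simp [hM, hj, phi, zeta]
    · rcases i with i | i <;> simp [hM]
  rw [hS, Matrix.det_fromBlocks_zero₂₁, Matrix.det_one] at hp
  rw [detS, ← hM, detYH]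
  rw [mul_one] at hp
  rw [hp]
  simp

end Ernst

namespace Ernst

open Matrix

/-! ### The real moment matrix and its kernels -/

/-- The moment `∫ t ^ m dμ` of the signed measure `μ` with density `p²` on `[1, x²]` and `q²` on
`[1, y²]` (oriented intervals), in closed form for `p² + q² = 1`. -/
noncomputable def moment (p q x y : ℝ) (m : ℕ) : ℝ :=
  (1 / ((m : ℝ) + 1)) * (p ^ 2 * (x ^ 2) ^ (m + 1) + q ^ 2 * (y ^ 2) ^ (m + 1) - 1)

/-- The `n × n` Hankel matrix of the moments of `μ`. -/
noncomputable def hankel (n : ℕ) (p q x y : ℝ) : Matrix (Fin n) (Fin n) ℝ :=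
  Matrix.of fun i j => moment p q x y ((i : ℕ) + (j : ℕ))

/-- The monomials `t ^ i` at `t = a²`. -/
noncomputable def mono (n : ℕ) (a : ℝ) : Fin n → ℝ := fun i => (a ^ 2) ^ (i : ℕ)

/-- The primitives of `s ↦ mono n s` vanishing at `0`. -/
noncomputable def prim (n : ℕ) (z : ℝ) : Fin n → ℝ := fun i => z ^ (2 * (i : ℕ) + 1) / (2 * ((i : ℕ) : ℝ) + 1)

/-- The bilinear form of the inverse moment matrix; on coefficient vectors of evaluations it
yields the reproducing kernel of the polynomials of degree `< n`. -/
noncomputable def bil (n : ℕ) (p q x y : ℝ) (u w : Fin n → ℝ) : ℝ := u ⬝ᵥ (hankel n p q x y)⁻¹ *ᵥ w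

/-- The reproducing (Christoffel-Darboux) kernel `K(a², b²)` of `μ`. -/
noncomputable def kap (n : ℕ) (p q x y a b : ℝ) : ℝ := bil n p q x y (mono n a) (mono n b)

/-- The primitive `∫₀^z K(a², s²) ds` of the reproducing kernel. -/
noncomputable def gam (n : ℕ) (p q x y a z : ℝ) : ℝ := bil n p q x y (mono n a) (prim n z)

theorem hankel_swap (n : ℕ) (p q x y : ℝ) : hankel n p q x y = hankel n q p y x := by
  ext i j; simp only [hankel, moment, Matrix.of_apply]; ring

theorem bil_swap (n : ℕ) (p q x y : ℝ) (u w : Fin n → ℝ) :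
    bil n p q x y u w = bil n q p y x u w := by rw [bil, hankel_swap, bil]

theorem kap_swap (n : ℕ) (p q x y a b : ℝ) : kap n p q x y a b = kap n q p y x a b :=
  bil_swap ..

theorem gam_swap (n : ℕ) (p q x y a b : ℝ) : gam n p q x y a b = gam n q p y x a b :=
  bil_swap ..

theorem hankel_transpose (n : ℕ) (p q x y : ℝ) : (hankel n p q x y)ᵀ = hankel n p q x y := by
  ext i j; simp [hankel, add_comm]

theorem bil_comm (n : ℕ) (p q x y : ℝ) (u w : Fin n → ℝ) :
    bil n p q x y u w = bil n p q x y w u := by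
  rw [bil, Matrix.dotProduct_mulVec, dotProduct_comm, ← Matrix.mulVec_transpose,
    Matrix.transpose_nonsing_inv, hankel_transpose, bil]

theorem kap_comm (n : ℕ) (p q x y a b : ℝ) : kap n p q x y a b = kap n p q x y b a := bil_comm ..

theorem bil_add_right (n : ℕ) (p q x y : ℝ) (u w w' : Fin n → ℝ) :
    bil n p q x y u (w + w') = bil n p q x y u w + bil n p q x y u w' := by
  simp [bil, Matrix.mulVec_add]

theorem bil_smul_right (n : ℕ) (p q x y c : ℝ) (u w : Fin n → ℝ) :
    bil n p q x y u (c • w) = c * bil n p q x y u w := by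
  simp [bil, Matrix.mulVec_smul]

theorem bil_smul_left (n : ℕ) (p q x y c : ℝ) (u w : Fin n → ℝ) :
    bil n p q x y (c • u) w = c * bil n p q x y u w := by
  simp [bil]

/-- A Lyapunov equation `X A + A Xᵀ = ∑ cₖ rₖ rₖᵀ` for the moment matrix `A`, read off on the
bilinear form of `A⁻¹`. All algebraic properties of the kernels used below are instances. -/
theorem bil_of_lyapunov {n : ℕ} {p q x y : ℝ} (hA : (hankel n p q x y).det ≠ 0)
    {X : Matrix (Fin n) (Fin n) ℝ} {r₀ r₁ r₂ : Fin n → ℝ} {c₀ c₁ c₂ : ℝ}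
    (h : X * hankel n p q x y + hankel n p q x y * Xᵀ =
      c₀ • vecMulVec r₀ r₀ + c₁ • vecMulVec r₁ r₁ + c₂ • vecMulVec r₂ r₂) (u w : Fin n → ℝ) :
    bil n p q x y u (X *ᵥ w) + bil n p q x y (X *ᵥ u) w =
      c₀ * (bil n p q x y u r₀ * bil n p q x y r₀ w)
        + c₁ * (bil n p q x y u r₁ * bil n p q x y r₁ w)
        + c₂ * (bil n p q x y u r₂ * bil n p q x y r₂ w) := by
  set A := hankel n p q x y with hAdef
  have hu : IsUnit A.det := isUnit_iff_ne_zero.2 hA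
  have h1 : A⁻¹ * X + Xᵀ * A⁻¹ = A⁻¹ * (X * A + A * Xᵀ) * A⁻¹ := by
    rw [Matrix.mul_add, Matrix.add_mul, Matrix.mul_assoc, Matrix.mul_assoc X,
      Matrix.mul_nonsing_inv A hu, Matrix.mul_one, ← Matrix.mul_assoc A⁻¹ A,
      Matrix.nonsing_inv_mul A hu, Matrix.one_mul]
  have h2 : bil n p q x y u (X *ᵥ w) + bil n p q x y (X *ᵥ u) w =
      u ⬝ᵥ (A⁻¹ * X + Xᵀ * A⁻¹) *ᵥ w := by
    rw [bil, bil, ← hAdef, Matrix.add_mulVec, dotProduct_add, ← Matrix.mulVec_mulVec,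
      ← Matrix.mulVec_mulVec, Matrix.dotProduct_mulVec u Xᵀ, Matrix.vecMul_transpose]
  have h3 : ∀ (c : ℝ) (r : Fin n → ℝ), u ⬝ᵥ (A⁻¹ * (c • vecMulVec r r) * A⁻¹) *ᵥ w =
      c * (bil n p q x y u r * bil n p q x y r w) := by
    intro c r
    rw [bil, bil, ← hAdef, Matrix.mul_smul, Matrix.smul_mul, Matrix.mul_vecMulVec,
      Matrix.vecMulVec_mul, Matrix.smul_mulVec, Matrix.vecMulVec_mulVec,
      Matrix.dotProduct_mulVec r]
    simp [dotProduct_comm, mul_comm]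
  rw [h2, h1, h]
  simp only [Matrix.mul_add, Matrix.add_mul, Matrix.add_mulVec, dotProduct_add, h3]

/-! ### Algebraic identities for the kernels -/

section Identities

variable {n : ℕ} {p q x y : ℝ}

/-- The pseudo-orthogonality relation: integration by parts expresses `∑ mₖ γ_a(cₖ) γ_b(cₖ)`, the
sum over the end points `c = 1, x, y` with the jumps `m = -1, p², q²` of the density, by the
reproducing property. -/
theorem gam_orthogonality (hA : (hankel n p q x y).det ≠ 0) (a b : ℝ) :
    2 * a * b * (p ^ 2 * gam n p q x y a x * gam n p q x y b x
      + q ^ 2 * gam n p q x y a y * gam n p q x y b y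
      - gam n p q x y a 1 * gam n p q x y b 1) =
      a * gam n p q x y a b + b * gam n p q x y b a := by
  set X : Matrix (Fin n) (Fin n) ℝ :=
    Matrix.diagonal fun i : Fin n => 1 / (2 * (2 * ((i : ℕ) : ℝ) + 1)) with hXdef
  have h := bil_of_lyapunov hA (X := X)
    (r₀ := prim n 1) (r₁ := prim n x) (r₂ := prim n y) (c₀ := -1) (c₁ := p ^ 2) (c₂ := q ^ 2)
    (by
      ext i j
      have h1 : 2 * ((i : ℕ) : ℝ) + 1 ≠ 0 := by positivity
      have h2 : 2 * ((j : ℕ) : ℝ) + 1 ≠ 0 := by positivity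
      have h3 : ((i : ℕ) : ℝ) + ((j : ℕ) : ℝ) + 1 ≠ 0 := by positivity
      simp only [hXdef, Matrix.diagonal_transpose, Matrix.add_apply, Matrix.diagonal_mul,
        Matrix.mul_diagonal, Matrix.smul_apply, vecMulVec_apply, smul_eq_mul, hankel,
        Matrix.of_apply, moment, prim, ← pow_mul, one_pow]
      push_cast
      field_simp
      ring)
    (mono n a) (mono n b)
  have hX : ∀ c : ℝ, (c * 2) • (X *ᵥ mono n c) = prim n c := by
    intro c
    ext i
    have h1 : 2 * ((i : ℕ) : ℝ) + 1 ≠ 0 := by positivity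
    simp only [hXdef, Pi.smul_apply, Matrix.mulVec_diagonal, mono, prim, smul_eq_mul, ← pow_mul]
    field_simp
    ring
  have h4 : ∀ c d : ℝ, gam n p q x y c d = (d * 2) * bil n p q x y (mono n c) (X *ᵥ mono n d) :=
    fun c d => by rw [← bil_smul_right, hX, gam]
  rw [bil_comm n p q x y (X *ᵥ _), bil_comm n p q x y (prim n 1), bil_comm n p q x y (prim n x),
    bil_comm n p q x y (prim n y)] at h
  rw [h4 a b, h4 b a]
  simp only [gam]
  linear_combination (-2 * a * b) * h

/-- The diagonal matrix of the Euler operator `2 t d/dt + 1` on monomials in `t`. -/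
noncomputable def eulerMatrix (n : ℕ) : Matrix (Fin n) (Fin n) ℝ :=
  Matrix.diagonal fun i => 2 * ((i : ℕ) : ℝ) + 1

theorem eulerMatrix_mulVec_prim (z : ℝ) : eulerMatrix n *ᵥ prim n z = z • mono n z := by
  ext i
  have h1 : 2 * ((i : ℕ) : ℝ) + 1 ≠ 0 := by positivity
  simp only [eulerMatrix, Pi.smul_apply, Matrix.mulVec_diagonal, mono, prim, smul_eq_mul,
    ← pow_mul]
  field_simp
  ring

/-- The scaling behaviour of the moments, on the level of the primitives of the kernel. -/
theorem gam_euler (hA : (hankel n p q x y).det ≠ 0) (a z : ℝ) :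
    bil n p q x y (eulerMatrix n *ᵥ mono n a) (prim n z) = -(z * kap n p q x y a z) +
      2 * (p ^ 2 * x ^ 2 * kap n p q x y a x * gam n p q x y x z
        + q ^ 2 * y ^ 2 * kap n p q x y a y * gam n p q x y y z
        - kap n p q x y a 1 * gam n p q x y 1 z) := by
  have h := bil_of_lyapunov hA (X := eulerMatrix n)
    (r₀ := mono n 1) (r₁ := mono n x) (r₂ := mono n y) (c₀ := -2) (c₁ := 2 * p ^ 2 * x ^ 2)
    (c₂ := 2 * q ^ 2 * y ^ 2)
    (by
      ext i j
      have h3 : ((i : ℕ) : ℝ) + ((j : ℕ) : ℝ) + 1 ≠ 0 := by positivity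
      simp only [eulerMatrix, Matrix.diagonal_transpose, Matrix.add_apply, Matrix.diagonal_mul,
        Matrix.mul_diagonal, Matrix.smul_apply, vecMulVec_apply, smul_eq_mul, hankel,
        Matrix.of_apply, moment, mono, one_pow]
      push_cast
      field_simp
      ring)
    (mono n a) (prim n z)
  rw [eulerMatrix_mulVec_prim, bil_smul_right] at h
  simp only [gam, kap]
  linear_combination h

/-- The matrix of `(t - 1) d/dt + 1/2` on monomials in `t`. -/
noncomputable def dilationMatrix (n : ℕ) : Matrix (Fin n) (Fin n) ℝ :=
  Matrix.of fun i k => (if k = i then ((i : ℕ) : ℝ) + 1 / 2 else 0)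
    - (if (k : ℕ) + 1 = (i : ℕ) then ((i : ℕ) : ℝ) else 0)

/-- At `i = 0` the truncated index `i - 1` is harmless: its coefficient vanishes. -/
theorem sum_dilationMatrix (i : Fin n) (f : ℕ → ℝ) :
    ∑ k : Fin n, dilationMatrix n i k * f k =
      (((i : ℕ) : ℝ) + 1 / 2) * f i - ((i : ℕ) : ℝ) * f ((i : ℕ) - 1) := by
  simp only [dilationMatrix, Matrix.of_apply, sub_mul, Finset.sum_sub_distrib, ite_mul, zero_mul]
  rw [Finset.sum_ite_eq' Finset.univ i, if_pos (Finset.mem_univ _)]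
  congr 1
  rcases Nat.eq_zero_or_pos (i : ℕ) with hi | hi
  · rw [Finset.sum_eq_zero, hi]
    · simp
    · intro k _
      rw [if_neg (by omega)]
  · rw [Finset.sum_eq_single (⟨(i : ℕ) - 1, by omega⟩ : Fin n)]
    · rw [if_pos (by simp; omega)]
    · intro k _ hk
      rw [if_neg]
      intro e
      exact hk (Fin.ext (by simp; omega))
    · simp

theorem dilationMatrix_mulVec_mono (a : ℝ) (i : Fin n) : (dilationMatrix n *ᵥ mono n a) i =
    (((i : ℕ) : ℝ) + 1 / 2) * (a ^ 2) ^ (i : ℕ) - ((i : ℕ) : ℝ) * (a ^ 2) ^ ((i : ℕ) - 1) :=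
  sum_dilationMatrix i fun k => (a ^ 2) ^ k

theorem natCast_mul_moment_pred (i j : ℕ) : (i : ℝ) * moment p q x y (i - 1 + j) =
    (i : ℝ) / ((i : ℝ) + j) * (p ^ 2 * (x ^ 2) ^ (i + j) + q ^ 2 * (y ^ 2) ^ (i + j) - 1) := by
  rcases i with _ | i
  · simp
  · rw [moment]
    simp only [Nat.add_sub_cancel]
    rw [show i + 1 + j = i + j + 1 by ring]
    push_cast
    rw [show (i : ℝ) + 1 + j = i + j + 1 by ring]
    ring

/-- The behaviour of the moments under dilations about `t = 1`: the end point `1` of the measure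
is fixed, so only the end points `x²` and `y²` contribute. -/
theorem dilationMatrix_lyapunov (hpq : p ^ 2 + q ^ 2 = 1) :
    dilationMatrix n * hankel n p q x y + hankel n p q x y * (dilationMatrix n)ᵀ =
      (0 : ℝ) • vecMulVec (mono n 1) (mono n 1)
        + (p ^ 2 * (x ^ 2 - 1)) • vecMulVec (mono n x) (mono n x)
        + (q ^ 2 * (y ^ 2 - 1)) • vecMulVec (mono n y) (mono n y) := by
  ext i j
  have e1 : (dilationMatrix n * hankel n p q x y) i j = _ :=
    sum_dilationMatrix i fun k => moment p q x y (k + j)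
  have e2 : (hankel n p q x y * (dilationMatrix n)ᵀ) i j = _ :=
    (Finset.sum_congr rfl fun k _ => by
      show moment p q x y ((i : ℕ) + k) * dilationMatrix n j k = _
      rw [mul_comm, add_comm (i : ℕ)]).trans
        (sum_dilationMatrix j fun k => moment p q x y (k + i))
  rw [Matrix.add_apply, e1, e2, natCast_mul_moment_pred, natCast_mul_moment_pred,
    add_comm (j : ℕ) (i : ℕ)]
  simp only [Matrix.add_apply, Matrix.smul_apply, vecMulVec_apply, smul_eq_mul, mono, moment]
  have h3 : ((i : ℕ) : ℝ) + ((j : ℕ) : ℝ) + 1 ≠ 0 := by positivity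
  rcases Nat.eq_zero_or_pos ((i : ℕ) + (j : ℕ)) with h0 | h0
  · have hi : (i : ℕ) = 0 := by omega
    have hj : (j : ℕ) = 0 := by omega
    simp only [hi, hj]
    norm_num
    linear_combination hpq
  · have h4 : ((i : ℕ) : ℝ) + ((j : ℕ) : ℝ) ≠ 0 := by exact_mod_cast h0.ne'
    have h5 : ((j : ℕ) : ℝ) + ((i : ℕ) : ℝ) ≠ 0 := by rwa [add_comm]
    push_cast
    field_simp
    ring

theorem kap_dilation (hpq : p ^ 2 + q ^ 2 = 1) (hA : (hankel n p q x y).det ≠ 0) (a : ℝ) :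
    bil n p q x y (mono n 1) (dilationMatrix n *ᵥ mono n a) = -(1 / 2 * kap n p q x y 1 a) +
      p ^ 2 * (x ^ 2 - 1) * kap n p q x y 1 x * kap n p q x y x a
        + q ^ 2 * (y ^ 2 - 1) * kap n p q x y 1 y * kap n p q x y y a := by
  have h := bil_of_lyapunov hA (dilationMatrix_lyapunov hpq) (mono n 1) (mono n a)
  have h1 : dilationMatrix n *ᵥ mono n 1 = (1 / 2 : ℝ) • mono n 1 := by
    ext i
    rw [dilationMatrix_mulVec_mono]
    simp [mono]
  rw [h1, bil_smul_left] at h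
  simp only [kap]
  linear_combination h

end Identities

/-! ### Derivatives of the kernels -/

section Derivatives

variable {n : ℕ} {p q x y : ℝ}

theorem hasDerivAt_inv_apply {ι : Type*} [Fintype ι] [DecidableEq ι] {A : ℝ → Matrix ι ι ℝ}
    {A' : Matrix ι ι ℝ} {s : ℝ} (hA : ∀ i j, HasDerivAt (fun t => A t i j) (A' i j) s)
    (hdet : (A s).det ≠ 0) (i j : ι) :
    HasDerivAt (fun t => (A t)⁻¹ i j) (-((A s)⁻¹ * A' * (A s)⁻¹) i j) s := by
  let : NormedRing (Matrix ι ι ℝ) := Matrix.linftyOpNormedRing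
  let : NormedAlgebra ℝ (Matrix ι ι ℝ) := Matrix.linftyOpNormedAlgebra
  have h1 : HasDerivAt A A' s := hasDerivAt_pi.2 fun i => hasDerivAt_pi.2 fun j => hA i j
  obtain ⟨U, hU⟩ := (Matrix.isUnit_iff_isUnit_det (A s)).2 (isUnit_iff_ne_zero.2 hdet)
  have h2 := hasFDerivAt_ringInverse (𝕜 := ℝ) U
  rw [hU] at h2
  have h3 := h2.comp_hasDerivAt s h1
  have h4 := hasDerivAt_pi.1 (hasDerivAt_pi.1 h3 i) j
  have e : (fun t => (A t)⁻¹ i j) = fun t => (Ring.inverse ∘ A) t i j := by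
    ext t; rw [Function.comp_apply, Matrix.nonsing_inv_eq_ringInverse]
  rw [e]
  refine h4.congr_deriv ?_
  have hUi : ((U⁻¹ : (Matrix ι ι ℝ)ˣ) : Matrix ι ι ℝ) = (A s)⁻¹ := by
    rw [Matrix.coe_units_inv, hU]
  simp [hUi]

theorem hasDerivAt_moment (m : ℕ) :
    HasDerivAt (fun s => moment p q s y m) (2 * p ^ 2 * x * (x ^ 2) ^ m) x := by
  have h := (((((hasDerivAt_id x).pow 2).pow (m + 1)).const_mul (p ^ 2)).add_const
    (q ^ 2 * (y ^ 2) ^ (m + 1))).sub_const 1 |>.const_mul (1 / ((m : ℝ) + 1))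
  refine h.congr_deriv ?_
  have : (m : ℝ) + 1 ≠ 0 := by positivity
  simp
  field_simp

theorem hasDerivAt_bil {u w : ℝ → Fin n → ℝ} {u' w' : Fin n → ℝ}
    (hA : (hankel n p q x y).det ≠ 0) (hu : ∀ i, HasDerivAt (fun s => u s i) (u' i) x)
    (hw : ∀ i, HasDerivAt (fun s => w s i) (w' i) x) :
    HasDerivAt (fun s => bil n p q s y (u s) (w s))
      (bil n p q x y u' (w x) + bil n p q x y (u x) w'
        - 2 * p ^ 2 * x * bil n p q x y (u x) (mono n x) * bil n p q x y (mono n x) (w x)) x := by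
  have hP := hasDerivAt_inv_apply (A := fun s => hankel n p q s y)
    (A' := (2 * p ^ 2 * x) • vecMulVec (mono n x) (mono n x)) (s := x)
    (fun i j => (hasDerivAt_moment ((i : ℕ) + (j : ℕ))).congr_deriv (by
      simp [vecMulVec_apply, mono, pow_add])) hA
  have h : HasDerivAt (fun s => ∑ i, u s i * ∑ j, (hankel n p q s y)⁻¹ i j * w s j) _ x :=
    HasDerivAt.fun_sum fun i _ => (hu i).mul (HasDerivAt.fun_sum fun j _ => (hP i j).mul (hw j))
  refine h.congr_deriv ?_
  set P := (hankel n p q x y)⁻¹ with hPdef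
  set Q := P * ((2 * p ^ 2 * x) • vecMulVec (mono n x) (mono n x)) * P with hQ
  have e : ∑ i, (u' i * ∑ j, P i j * w x j + u x i * ∑ j, (-Q i j * w x j + P i j * w' j)) =
      u' ⬝ᵥ P *ᵥ w x + u x ⬝ᵥ P *ᵥ w' - u x ⬝ᵥ Q *ᵥ w x := by
    simp only [dotProduct, Matrix.mulVec, ← Finset.sum_add_distrib, ← Finset.sum_sub_distrib]
    refine Finset.sum_congr rfl fun i _ => ?_
    simp only [Finset.sum_add_distrib, neg_mul, Finset.sum_neg_distrib]
    ring
  refine e.trans ?_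
  have h3 : u x ⬝ᵥ Q *ᵥ w x = 2 * p ^ 2 * x * bil n p q x y (u x) (mono n x) *
      bil n p q x y (mono n x) (w x) := by
    rw [bil, bil, ← hPdef, hQ, Matrix.mul_smul, Matrix.smul_mul, Matrix.mul_vecMulVec,
      Matrix.vecMulVec_mul, Matrix.smul_mulVec, Matrix.vecMulVec_mulVec,
      Matrix.dotProduct_mulVec (mono n x)]
    simp [dotProduct_comm]
    ring
  rw [h3]
  rfl

theorem hasDerivAt_gam (hA : (hankel n p q x y).det ≠ 0) (a z : ℝ) :
    HasDerivAt (fun s => gam n p q s y a z)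
      (-(2 * p ^ 2 * x * kap n p q x y a x * gam n p q x y x z)) x := by
  have h := hasDerivAt_bil (u := fun _ => mono n a) (w := fun _ => prim n z) (u' := 0) (w' := 0) hA
    (fun i => hasDerivAt_const _ _) (fun i => hasDerivAt_const _ _)
  refine h.congr_deriv ?_
  simp [bil, kap, gam]

theorem hasDerivAt_prim (z : ℝ) (i : Fin n) :
    HasDerivAt (fun s => prim n s i) (mono n z i) z := by
  have h := (hasDerivAt_pow (2 * (i : ℕ) + 1) z).div_const (2 * ((i : ℕ) : ℝ) + 1)
  refine h.congr_deriv ?_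
  have h1 : 2 * ((i : ℕ) : ℝ) + 1 ≠ 0 := by positivity
  simp only [mono, Nat.add_sub_cancel, ← pow_mul]
  push_cast
  field_simp

theorem hasDerivAt_gam_self (hA : (hankel n p q x y).det ≠ 0) (a : ℝ) :
    HasDerivAt (fun s => gam n p q s y a s)
      (kap n p q x y a x - 2 * p ^ 2 * x * kap n p q x y a x * gam n p q x y x x) x := by
  have h := hasDerivAt_bil (u := fun _ => mono n a) (w := fun s => prim n s) (u' := 0) hA
    (fun i => hasDerivAt_const _ _) (hasDerivAt_prim x)
  refine h.congr_deriv ?_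
  simp [bil, kap, gam]

theorem hasDerivAt_mul_mono (i : Fin n) :
    HasDerivAt (fun s => (s • mono n s) i) ((eulerMatrix n *ᵥ mono n x) i) x := by
  have h : HasDerivAt (fun s : ℝ => s ^ (2 * (i : ℕ) + 1)) _ x := hasDerivAt_pow _ x
  have e : (fun s => (s • mono n s) i) = fun s : ℝ => s ^ (2 * (i : ℕ) + 1) := by
    ext s; rw [Pi.smul_apply, mono, smul_eq_mul, ← pow_mul, pow_succ']
  rw [e]
  refine h.congr_deriv ?_
  simp [eulerMatrix, Matrix.mulVec_diagonal, mono, ← pow_mul]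

theorem hasDerivAt_mul_gam (hA : (hankel n p q x y).det ≠ 0) (z : ℝ) :
    HasDerivAt (fun s => s * gam n p q s y s z) (-(z * kap n p q x y x z) +
      2 * (q ^ 2 * y ^ 2 * kap n p q x y x y * gam n p q x y y z
        - kap n p q x y 1 x * gam n p q x y 1 z)) x := by
  have h := hasDerivAt_bil (u := fun s => s • mono n s) (w := fun _ => prim n z) (w' := 0) hA
    hasDerivAt_mul_mono (fun i => hasDerivAt_const _ _)
  have e : (fun s => s * gam n p q s y s z) = fun s => bil n p q s y (s • mono n s) (prim n z) := by
    ext s; rw [bil_smul_left, gam]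
  rw [e]
  refine h.congr_deriv ?_
  have h0 : bil n p q x y (x • mono n x) 0 = 0 := by simp [bil]
  rw [gam_euler hA, h0, bil_smul_left, kap_comm n p q x y x 1]
  simp only [kap, gam]
  ring

theorem hasDerivAt_mul_gam_self (hA : (hankel n p q x y).det ≠ 0) :
    HasDerivAt (fun s => s * gam n p q s y s s)
      (2 * (q ^ 2 * y ^ 2 * kap n p q x y x y * gam n p q x y y x
        - kap n p q x y 1 x * gam n p q x y 1 x)) x := by
  have h := hasDerivAt_bil (u := fun s => s • mono n s) (w := fun s => prim n s) hA
    hasDerivAt_mul_mono (hasDerivAt_prim x)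
  have e : (fun s => s * gam n p q s y s s) = fun s => bil n p q s y (s • mono n s) (prim n s) := by
    ext s; rw [bil_smul_left, gam]
  rw [e]
  refine h.congr_deriv ?_
  rw [gam_euler hA, bil_smul_left, kap_comm n p q x y x 1]
  simp only [kap, gam]
  ring

theorem hasDerivAt_mono (i : Fin n) : HasDerivAt (fun s => mono n s i)
    (2 * x * (((i : ℕ) : ℝ) * (x ^ 2) ^ ((i : ℕ) - 1))) x := by
  have h := ((hasDerivAt_id x).pow 2).pow (i : ℕ)
  refine h.congr_deriv ?_
  simp
  ring

/-- The derivative of the reproducing kernel between the fixed end point `1` and the moving end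
point `x²`. By homogeneity under dilations about `t = 1`, the motion of `x²` is traded for the
opposite motion of `y²`, to which the kernel responds only through the measure. -/
theorem hasDerivAt_mul_kap (hpq : p ^ 2 + q ^ 2 = 1) (hA : (hankel n p q x y).det ≠ 0) :
    HasDerivAt (fun s => (s ^ 2 - 1) * kap n p q s y 1 s)
      (2 * x * q ^ 2 * (y ^ 2 - 1) * kap n p q x y 1 y * kap n p q x y x y) x := by
  have h := (((hasDerivAt_id x).pow 2).sub_const 1).mul
    (hasDerivAt_bil (u := fun _ => mono n 1) (w := fun s => mono n s) (u' := 0) hA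
      (fun i => hasDerivAt_const _ _) hasDerivAt_mono)
  refine h.congr_deriv ?_
  have e : (x ^ 2 - 1) • (fun i : Fin n => 2 * x * (((i : ℕ) : ℝ) * (x ^ 2) ^ ((i : ℕ) - 1))) =
      (2 * x) • (dilationMatrix n *ᵥ mono n x + (-(1 / 2) : ℝ) • mono n x) := by
    ext i
    simp only [Pi.smul_apply, Pi.add_apply, dilationMatrix_mulVec_mono, smul_eq_mul, mono]
    rcases Nat.eq_zero_or_pos (i : ℕ) with hi | hi
    · simp [hi]
    · obtain ⟨k, hk⟩ : ∃ k, (i : ℕ) = k + 1 := ⟨(i : ℕ) - 1, by omega⟩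
      rw [hk]
      simp only [Nat.add_sub_cancel]
      ring
  have e' := congrArg (bil n p q x y (mono n 1)) e
  rw [bil_smul_right, bil_smul_right, bil_add_right, bil_smul_right, kap_dilation hpq hA] at e'
  have h0 : bil n p q x y 0 (mono n x) = 0 := by simp [bil]
  have hc := kap_comm n p q x y x y
  simp only [kap] at *
  simp only [id, h0, Nat.cast_ofNat, mul_one, Nat.add_one_sub_one, pow_one, zero_add, Pi.pow_apply]
  linear_combination e' - 2 * x * q ^ 2 * (y ^ 2 - 1) * bil n p q x y (mono n 1) (mono n y) * hc

end Derivatives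

end Ernst

namespace Ernst

open Matrix Filter Topology

/-! ### The Ernst equation where the moment matrix is invertible -/

section Frame

variable {n : ℕ} {p q x y : ℝ}

theorem contDiff_moment (p q : ℝ) (m : ℕ) {k : WithTop ℕ∞} :
    ContDiff ℝ k fun w : ℝ × ℝ => moment p q w.1 w.2 m := by
  unfold moment; fun_prop

theorem contDiff_det {ι : Type*} [Fintype ι] [DecidableEq ι] {k : WithTop ℕ∞}
    {M : ℝ × ℝ → Matrix ι ι ℝ} (hM : ∀ i j, ContDiff ℝ k fun w => M w i j) :
    ContDiff ℝ k fun w => (M w).det := by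
  simp only [Matrix.det_apply]
  exact ContDiff.sum fun σ _ => (contDiff_prod fun i _ => hM _ _).const_smul _

theorem contDiff_det_hankel (n : ℕ) (p q : ℝ) {k : WithTop ℕ∞} :
    ContDiff ℝ k fun w : ℝ × ℝ => (hankel n p q w.1 w.2).det := by
  refine contDiff_det (M := fun w : ℝ × ℝ => hankel n p q w.1 w.2) fun i j => ?_
  simp only [hankel, Matrix.of_apply]
  exact contDiff_moment p q ((i : ℕ) + (j : ℕ))

theorem eventually_det_ne_zero (hA : (hankel n p q x y).det ≠ 0) :
    ∀ᶠ s in 𝓝 x, (hankel n p q s y).det ≠ 0 := by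
  have h := (contDiff_det_hankel n p q (k := 0)).continuous.continuousAt.eventually_ne
    (x := (x, y)) hA
  exact (Continuous.prodMk_left y).continuousAt.eventually h

theorem hasDerivAt_gam_one (hA : (hankel n p q x y).det ≠ 0) (z : ℝ) :
    HasDerivAt (fun s => gam n p q s y 1 z)
      (kap n p q x y 1 x * (-(2 * p ^ 2) * (x * gam n p q x y x z))) x :=
  (hasDerivAt_gam hA 1 z).congr_deriv (by ring)

theorem hasDerivAt_gam_one_self (hA : (hankel n p q x y).det ≠ 0) :
    HasDerivAt (fun s => gam n p q s y 1 s)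
      (kap n p q x y 1 x * (1 + -(2 * p ^ 2) * (x * gam n p q x y x x))) x :=
  (hasDerivAt_gam_self hA 1).congr_deriv (by ring)

theorem hasDerivAt_flux (hpq : p ^ 2 + q ^ 2 = 1) (hA : (hankel n p q x y).det ≠ 0) (z : ℝ) :
    HasDerivAt (fun s => (s ^ 2 - 1) *
        (kap n p q s y 1 s * (-(2 * p ^ 2) * (s * gam n p q s y s z))))
      (2 * x * q ^ 2 * (y ^ 2 - 1) * kap n p q x y 1 y * kap n p q x y x y *
          (-(2 * p ^ 2) * (x * gam n p q x y x z)) +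
        (x ^ 2 - 1) * kap n p q x y 1 x * (-(2 * p ^ 2) * (-(z * kap n p q x y x z) +
          2 * (q ^ 2 * y ^ 2 * kap n p q x y x y * gam n p q x y y z
            - kap n p q x y 1 x * gam n p q x y 1 z)))) x := by
  have h := (hasDerivAt_mul_kap hpq hA).mul ((hasDerivAt_mul_gam hA z).const_mul (-(2 * p ^ 2)))
  refine (h.congr_deriv rfl).congr_of_eventuallyEq (Eventually.of_forall fun s => ?_)
  simp only [Pi.mul_apply]
  ring

theorem hasDerivAt_flux_self (hpq : p ^ 2 + q ^ 2 = 1) (hA : (hankel n p q x y).det ≠ 0) :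
    HasDerivAt (fun s => (s ^ 2 - 1) *
        (kap n p q s y 1 s * (1 + -(2 * p ^ 2) * (s * gam n p q s y s s))))
      (2 * x * q ^ 2 * (y ^ 2 - 1) * kap n p q x y 1 y * kap n p q x y x y *
          (1 + -(2 * p ^ 2) * (x * gam n p q x y x x)) +
        (x ^ 2 - 1) * kap n p q x y 1 x * (-(2 * p ^ 2) *
          (2 * (q ^ 2 * y ^ 2 * kap n p q x y x y * gam n p q x y y x
            - kap n p q x y 1 x * gam n p q x y 1 x)))) x := by
  have h := (hasDerivAt_mul_kap hpq hA).mul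
    (((hasDerivAt_mul_gam_self hA).const_mul (-(2 * p ^ 2))).const_add 1)
  refine (h.congr_deriv rfl).congr_of_eventuallyEq (Eventually.of_forall fun s => ?_)
  simp only [Pi.mul_apply]
  ring

end Frame

/-- The first derivative of a quotient and the derivative of its flux `c f'`, in terms of the
derivatives and fluxes of numerator and denominator. -/
theorem deriv_flux_div {f ζ w c ζ' w' : ℝ → ℂ} {dζ dw : ℂ} {x : ℝ}
    (hf : f =ᶠ[𝓝 x] fun s => ζ s / w s)
    (hζ : ∀ᶠ s in 𝓝 x, HasDerivAt ζ (ζ' s) s) (hw : ∀ᶠ s in 𝓝 x, HasDerivAt w (w' s) s)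
    (hw0 : w x ≠ 0)
    (hdζ : HasDerivAt (fun s => c s * ζ' s) dζ x) (hdw : HasDerivAt (fun s => c s * w' s) dw x) :
    deriv f x = (ζ' x * w x - ζ x * w' x) / w x ^ 2 ∧
      deriv (fun s => c s * deriv f s) x = (dζ * w x - ζ x * dw) / w x ^ 2
        - 2 * c x * w' x * (ζ' x * w x - ζ x * w' x) / w x ^ 3 := by
  have hw1 : ∀ᶠ s in 𝓝 x, w s ≠ 0 := hw.self_of_nhds.continuousAt.eventually_ne hw0
  have h1 : ∀ᶠ s in 𝓝 x, deriv f s = (ζ' s * w s - ζ s * w' s) / w s ^ 2 := by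
    filter_upwards [hf.eventuallyEq_nhds, hζ, hw, hw1] with s h h2 h3 h4
    rw [h.deriv_eq]
    exact (h2.div h3 h4).deriv
  refine ⟨h1.self_of_nhds, ?_⟩
  have h2 : (fun s => c s * deriv f s) =ᶠ[𝓝 x]
      fun s => ((c s * ζ' s) * w s - ζ s * (c s * w' s)) / w s ^ 2 := by
    filter_upwards [h1] with s h
    rw [h]; ring
  rw [h2.deriv_eq]
  have h3 := (((hdζ.mul hw.self_of_nhds).sub (hζ.self_of_nhds.mul hdw)).div
    (hw.self_of_nhds.pow 2) (pow_ne_zero 2 hw0)).deriv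
  refine h3.trans ?_
  simp only [Pi.mul_apply, Pi.sub_apply, Pi.pow_apply]
  field_simp
  push_cast
  ring

/-- The passage from the vector `(w, u, v)`, `ζ = u - i v`, to its stereographic projection `ζ / w`:
the harmonic map equations `Δζ = λ ζ`, `Δw = λ (w + 1/2)` for a vector on the quadric
`|ζ|² = w² + w` become the Ernst equation. The letters `ζc`, `ζ₁c`, `ζ₂c` stand for the complex
conjugates, the indices for the two partial derivatives and `a₁`, `a₂` for their weights. -/
theorem stereographic_ernst {ζ ζc w ζ₁ ζ₁c w₁ ζ₂ ζ₂c w₂ a₁ a₂ dζ₁ dζ₂ dw₁ dw₂ l : ℂ}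
    (hw : w ≠ 0) (h : ζ * ζc = w ^ 2 + w)
    (h₁ : ζ₁ * ζc + ζ * ζ₁c = (1 + 2 * w) * w₁) (h₂ : ζ₂ * ζc + ζ * ζ₂c = (1 + 2 * w) * w₂)
    (hl : l = 4 * (a₁ * (ζ₁ * ζ₁c - w₁ ^ 2) + a₂ * (ζ₂ * ζ₂c - w₂ ^ 2)))
    (hζ : dζ₁ + dζ₂ = l * ζ) (hdw : dw₁ + dw₂ = l * (1 + 2 * w) / 2) :
    (ζ / w * (ζc / w) - 1) *
        (((dζ₁ * w - ζ * dw₁) / w ^ 2 - 2 * a₁ * w₁ * (ζ₁ * w - ζ * w₁) / w ^ 3) +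
          ((dζ₂ * w - ζ * dw₂) / w ^ 2 - 2 * a₂ * w₂ * (ζ₂ * w - ζ * w₂) / w ^ 3)) =
      2 * (ζc / w) * (a₁ * ((ζ₁ * w - ζ * w₁) / w ^ 2) ^ 2
        + a₂ * ((ζ₂ * w - ζ * w₂) / w ^ 2) ^ 2) := by
  have e1 : ζ / w * (ζc / w) - 1 = 1 / w := by
    field_simp
    linear_combination h
  rw [e1]
  have hX : ∀ {ζ' ζ'c w' : ℂ}, ζ' * ζc + ζ * ζ'c = (1 + 2 * w) * w' →
      (ζ' * ζ'c - w' ^ 2) * ζ * w ^ 2 + w' * w * (ζ' * w - ζ * w')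
        + ζc * (ζ' * w - ζ * w') ^ 2 = 0 := by
    intro ζ' ζ'c w' h'
    linear_combination w ^ 2 * ζ' * h' - (2 * w * w' * ζ' - ζ * w' ^ 2) * h
  have hd : (dζ₁ * w - ζ * dw₁) + (dζ₂ * w - ζ * dw₂) = -(l * ζ / 2) := by
    linear_combination w * hζ - ζ * hdw
  rw [← sub_eq_zero]
  have e2 : ∀ A₁ A₂ b₁ b₂ : ℂ, 1 / w * ((A₁ / w ^ 2 - 2 * a₁ * w₁ * b₁ / w ^ 3) +
      (A₂ / w ^ 2 - 2 * a₂ * w₂ * b₂ / w ^ 3)) -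
      2 * (ζc / w) * (a₁ * (b₁ / w ^ 2) ^ 2 + a₂ * (b₂ / w ^ 2) ^ 2) =
      ((A₁ + A₂) * w ^ 2 - 2 * a₁ * (w₁ * w * b₁ + ζc * b₁ ^ 2)
        - 2 * a₂ * (w₂ * w * b₂ + ζc * b₂ ^ 2)) / w ^ 5 := by
    intro A₁ A₂ b₁ b₂
    field_simp
    ring
  rw [e2, hd, hl, div_eq_zero_iff]
  left
  linear_combination (-2 * a₁) * hX h₁ - 2 * a₂ * hX h₂


/-- The potential in terms of the reproducing kernel: `(p g(x) - i q g(y)) / g(1)` with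
`g(z) = ∫₀^z K(1, s²) ds`. -/
noncomputable def kernelPotential (n : ℕ) (p q x y : ℝ) : ℂ :=
  (((p * gam n p q x y 1 x : ℝ) : ℂ) - Complex.I * ((q * gam n p q x y 1 y : ℝ) : ℂ)) /
    ((gam n p q x y 1 1 : ℝ) : ℂ)

theorem prolate_equation_of_det_ne_zero {n : ℕ} {p q x y : ℝ} (hpq : p ^ 2 + q ^ 2 = 1)
    (hA : (hankel n p q x y).det ≠ 0) (hw : gam n p q x y 1 1 ≠ 0) {ξ : ℝ → ℝ → ℂ}
    (hξ : ∀ᶠ w in 𝓝 (x, y), ξ w.1 w.2 = kernelPotential n p q w.1 w.2) :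
    (ξ x y * conj (ξ x y) - 1) *
        (deriv (fun s : ℝ => ((s : ℂ) ^ 2 - 1) * deriv (fun t => ξ t y) s) x
          + deriv (fun s : ℝ => (1 - (s : ℂ) ^ 2) * deriv (fun t => ξ x t) s) y) =
      2 * conj (ξ x y) *
        (((x : ℂ) ^ 2 - 1) * deriv (fun s => ξ s y) x ^ 2
          + (1 - (y : ℂ) ^ 2) * deriv (fun s => ξ x s) y ^ 2) := by
  have hA' : (hankel n q p y x).det ≠ 0 := by rwa [← hankel_swap]
  have hqp : q ^ 2 + p ^ 2 = 1 := by rw [add_comm]; exact hpq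
  have evx := eventually_det_ne_zero hA
  have evy := eventually_det_ne_zero hA'
  -- the derivatives in the direction of `x`
  have hx := deriv_flux_div (c := fun s : ℝ => (s : ℂ) ^ 2 - 1)
    (f := fun s => ξ s y)
    (ζ := fun s => ((p * gam n p q s y 1 s : ℝ) : ℂ) - Complex.I * ((q * gam n p q s y 1 y : ℝ) : ℂ))
    (w := fun s => ((gam n p q s y 1 1 : ℝ) : ℂ)) (x := x)
    ((Continuous.prodMk_left y).continuousAt.eventually hξ)
    (evx.mono fun s hs => ((hasDerivAt_gam_one_self hs).const_mul p).ofReal_comp.sub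
      ((((hasDerivAt_gam_one hs y).const_mul q).ofReal_comp).const_mul Complex.I))
    (evx.mono fun s hs => (hasDerivAt_gam_one hs 1).ofReal_comp)
    (by exact_mod_cast hw)
    ((((hasDerivAt_flux_self hpq hA).const_mul p).ofReal_comp.sub
      ((((hasDerivAt_flux hpq hA y).const_mul q).ofReal_comp).const_mul
        Complex.I)).congr_of_eventuallyEq (Eventually.of_forall fun s => by simp; ring))
    ((hasDerivAt_flux hpq hA 1).ofReal_comp.congr_of_eventuallyEq
      (Eventually.of_forall fun s => by simp))
  -- the derivatives in the direction of `y`, by exchanging `(p, x)` and `(q, y)`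
  have hy := deriv_flux_div (c := fun s : ℝ => 1 - (s : ℂ) ^ 2)
    (f := fun s => ξ x s)
    (ζ := fun s => ((p * gam n q p s x 1 x : ℝ) : ℂ) - Complex.I * ((q * gam n q p s x 1 s : ℝ) : ℂ))
    (w := fun s => ((gam n q p s x 1 1 : ℝ) : ℂ)) (x := y)
    (((Continuous.prodMk_right x).continuousAt.eventually hξ).mono fun s hs => by
      refine hs.trans ?_
      simp only [kernelPotential, gam_swap n p q])
    (evy.mono fun s hs => ((hasDerivAt_gam_one hs x).const_mul p).ofReal_comp.sub
      ((((hasDerivAt_gam_one_self hs).const_mul q).ofReal_comp).const_mul Complex.I))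
    (evy.mono fun s hs => (hasDerivAt_gam_one hs 1).ofReal_comp)
    (by rw [gam_swap] at hw; exact_mod_cast hw)
    ((((hasDerivAt_flux hqp hA' x).const_mul (-p)).ofReal_comp.sub
      ((((hasDerivAt_flux_self hqp hA').const_mul (-q)).ofReal_comp).const_mul
        Complex.I)).congr_of_eventuallyEq (Eventually.of_forall fun s => by simp; ring))
    ((((hasDerivAt_flux hqp hA' 1).const_mul (-1))).ofReal_comp.congr_of_eventuallyEq
      (Eventually.of_forall fun s => by simp; ring))
  have hξ0 : ξ x y = kernelPotential n p q x y := hξ.self_of_nhds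
  have hI : Complex.I ^ 2 = -1 := Complex.I_sq
  have n₀ := gam_orthogonality hA 1 1
  have n₁ := gam_orthogonality hA x x
  have n₂ := gam_orthogonality hA y y
  have n₀₁ := gam_orthogonality hA 1 x
  have n₀₂ := gam_orthogonality hA 1 y
  have hconj : conj (kernelPotential n p q x y) = (((p * gam n p q x y 1 x : ℝ) : ℂ) +
      Complex.I * ((q * gam n p q x y 1 y : ℝ) : ℂ)) / ((gam n p q x y 1 1 : ℝ) : ℂ) := by
    simp only [kernelPotential, map_div₀, map_sub, map_mul, Complex.conj_ofReal, Complex.conj_I]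
    ring
  rw [hx.1, hx.2, hy.1, hy.2, hξ0, hconj, kernelPotential]
  simp only [gam_swap n q p, kap_swap n q p, kap_comm n p q x y y x, kap_comm n p q x y x 1,
    kap_comm n p q x y y 1]
  generalize gam n p q x y 1 1 = g00 at *
  generalize gam n p q x y 1 x = g01 at *
  generalize gam n p q x y 1 y = g02 at *
  generalize gam n p q x y x 1 = g10 at *
  generalize gam n p q x y x x = g11 at *
  generalize gam n p q x y x y = g12 at *
  generalize gam n p q x y y 1 = g20 at *
  generalize gam n p q x y y x = g21 at *
  generalize gam n p q x y y y = g22 at *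
  generalize kap n p q x y 1 x = k01 at *
  generalize kap n p q x y 1 y = k02 at *
  generalize kap n p q x y x y = k12 at *
  have hw' : (g00 : ℂ) ≠ 0 := by exact_mod_cast hw
  clear hx hy hξ0 hξ hconj evx evy hA hA'
  replace n₀ := congrArg (fun r : ℝ => (r : ℂ)) n₀
  replace n₁ := congrArg (fun r : ℝ => (r : ℂ)) n₁
  replace n₂ := congrArg (fun r : ℝ => (r : ℂ)) n₂
  replace n₀₁ := congrArg (fun r : ℝ => (r : ℂ)) n₀₁
  replace n₀₂ := congrArg (fun r : ℝ => (r : ℂ)) n₀₂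
  push_cast at n₀ n₁ n₂ n₀₁ n₀₂
  refine stereographic_ernst
    (ζ₁c := ((p * (k01 * (1 + -(2 * p ^ 2) * (x * g11))) : ℝ) : ℂ) +
      Complex.I * ((q * (k01 * (-(2 * p ^ 2) * (x * g12))) : ℝ) : ℂ))
    (ζ₂c := ((p * (k02 * (-(2 * q ^ 2) * (y * g21))) : ℝ) : ℂ) +
      Complex.I * ((q * (k02 * (1 + -(2 * q ^ 2) * (y * g22))) : ℝ) : ℂ))
    (l := 4 * (((x : ℂ) ^ 2 - 1) * p ^ 2 * k01 ^ 2 + (1 - (y : ℂ) ^ 2) * q ^ 2 * k02 ^ 2))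
    hw' ?_ ?_ ?_ ?_ ?_ ?_
  · push_cast
    linear_combination (1 / 2 : ℂ) * n₀ - (q : ℂ) ^ 2 * g02 ^ 2 * hI
  · push_cast
    linear_combination (-2 * (p : ℂ) ^ 2 * k01) * n₀₁ +
      4 * (p : ℂ) ^ 2 * q ^ 2 * k01 * x * g02 * g12 * hI
  · push_cast
    linear_combination (-2 * (q : ℂ) ^ 2 * k02) * n₀₂ -
      2 * (q : ℂ) ^ 2 * k02 * g02 * (1 - 2 * q ^ 2 * y * g22) * hI
  · push_cast
    linear_combination (-8 * ((x : ℂ) ^ 2 - 1) * p ^ 4 * k01 ^ 2) * n₁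
      - (8 * (1 - (y : ℂ) ^ 2) * q ^ 4 * k02 ^ 2) * n₂
      + (4 * ((x : ℂ) ^ 2 - 1) * (q * (k01 * (-(2 * p ^ 2) * (x * g12)))) ^ 2
        + 4 * (1 - (y : ℂ) ^ 2) * (q * (k02 * (1 + -(2 * q ^ 2) * (y * g22)))) ^ 2) * hI
  · push_cast
    ring
  · push_cast
    ring

end Ernst

namespace Ernst

open Filter Topology

/-! ### Partial derivatives -/

section Partial

variable {F : ℝ × ℝ → ℂ} {U : Set (ℝ × ℝ)}

/-- The partial derivative in the first variable. -/
noncomputable def pd₁ (F : ℝ × ℝ → ℂ) (w : ℝ × ℝ) : ℂ := fderiv ℝ F w (1, 0)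

/-- The partial derivative in the second variable. -/
noncomputable def pd₂ (F : ℝ × ℝ → ℂ) (w : ℝ × ℝ) : ℂ := fderiv ℝ F w (0, 1)

theorem hasDerivAt_comp_curve {X Y : ℝ → ℝ} {X' Y' t : ℝ}
    (hF : DifferentiableAt ℝ F (X t, Y t)) (hX : HasDerivAt X X' t) (hY : HasDerivAt Y Y' t) :
    HasDerivAt (fun s => F (X s, Y s)) (X' * pd₁ F (X t, Y t) + Y' * pd₂ F (X t, Y t)) t := by
  have h := hF.hasFDerivAt.comp_hasDerivAt t (hX.prodMk hY)
  refine h.congr_deriv ?_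
  have e : (X', Y') = X' • ((1 : ℝ), (0 : ℝ)) + Y' • ((0 : ℝ), (1 : ℝ)) := by simp
  rw [e, map_add, map_smul, map_smul]
  simp [pd₁, pd₂]

theorem contDiffOn_pd₁ {k m : WithTop ℕ∞} (hU : IsOpen U) (hF : ContDiffOn ℝ k F U)
    (hm : m + 1 ≤ k) : ContDiffOn ℝ m (pd₁ F) U :=
  (hF.fderiv_of_isOpen hU hm).clm_apply contDiffOn_const

theorem contDiffOn_pd₂ {k m : WithTop ℕ∞} (hU : IsOpen U) (hF : ContDiffOn ℝ k F U)
    (hm : m + 1 ≤ k) : ContDiffOn ℝ m (pd₂ F) U :=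
  (hF.fderiv_of_isOpen hU hm).clm_apply contDiffOn_const

theorem differentiableAt_of_contDiffOn {k : WithTop ℕ∞} (hU : IsOpen U) (hF : ContDiffOn ℝ k F U)
    (hk : k ≠ 0) {w : ℝ × ℝ} (hw : w ∈ U) : DifferentiableAt ℝ F w :=
  (hF.contDiffAt (hU.mem_nhds hw)).differentiableAt hk

/-- First and second derivative of a function of two variables along a curve. -/
theorem deriv_deriv_comp_curve (hU : IsOpen U) (hF : ContDiffOn ℝ 2 F U) {X Y X' Y' : ℝ → ℝ}
    {X'' Y'' t : ℝ} (ht : (X t, Y t) ∈ U) (hX : ∀ᶠ s in 𝓝 t, HasDerivAt X (X' s) s)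
    (hY : ∀ᶠ s in 𝓝 t, HasDerivAt Y (Y' s) s) (hX' : HasDerivAt X' X'' t)
    (hY' : HasDerivAt Y' Y'' t) :
    deriv (fun s => F (X s, Y s)) t = X' t * pd₁ F (X t, Y t) + Y' t * pd₂ F (X t, Y t) ∧
      HasDerivAt (deriv fun s => F (X s, Y s))
        (X'' * pd₁ F (X t, Y t)
          + X' t * (X' t * pd₁ (pd₁ F) (X t, Y t) + Y' t * pd₂ (pd₁ F) (X t, Y t))
          + (Y'' * pd₂ F (X t, Y t)
          + Y' t * (X' t * pd₁ (pd₂ F) (X t, Y t) + Y' t * pd₂ (pd₂ F) (X t, Y t)))) t := by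
  have hX0 := hX.self_of_nhds
  have hY0 := hY.self_of_nhds
  have hev : ∀ᶠ s in 𝓝 t, (X s, Y s) ∈ U :=
    (hX0.continuousAt.prodMk hY0.continuousAt).eventually (hU.mem_nhds ht)
  have h1 : deriv (fun s => F (X s, Y s)) =ᶠ[𝓝 t]
      fun s => X' s * pd₁ F (X s, Y s) + Y' s * pd₂ F (X s, Y s) := by
    filter_upwards [hX, hY, hev] with s h2 h3 h4
    exact (hasDerivAt_comp_curve (differentiableAt_of_contDiffOn hU hF two_ne_zero h4) h2 h3).deriv
  have d1 := differentiableAt_of_contDiffOn hU (contDiffOn_pd₁ hU hF one_add_one_eq_two.le)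
    one_ne_zero ht
  have d2 := differentiableAt_of_contDiffOn hU (contDiffOn_pd₂ hU hF one_add_one_eq_two.le)
    one_ne_zero ht
  refine ⟨h1.self_of_nhds, HasDerivAt.congr_of_eventuallyEq ?_ h1⟩
  exact (hX'.ofReal_comp.mul (hasDerivAt_comp_curve d1 hX0 hY0)).add
    (hY'.ofReal_comp.mul (hasDerivAt_comp_curve d2 hX0 hY0))

/-- The defect of the prolate Ernst equation in terms of partial derivatives. -/
noncomputable def prolateDefect (F : ℝ × ℝ → ℂ) (w : ℝ × ℝ) : ℂ :=
  (F w * conj (F w) - 1) *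
      ((2 * (w.1 : ℂ) * pd₁ F w + ((w.1 : ℂ) ^ 2 - 1) * pd₁ (pd₁ F) w)
        + (-(2 * (w.2 : ℂ)) * pd₂ F w + (1 - (w.2 : ℂ) ^ 2) * pd₂ (pd₂ F) w)) -
    2 * conj (F w) * (((w.1 : ℂ) ^ 2 - 1) * pd₁ F w ^ 2 + (1 - (w.2 : ℂ) ^ 2) * pd₂ F w ^ 2)

theorem continuousOn_prolateDefect (hU : IsOpen U) (hF : ContDiffOn ℝ 2 F U) :
    ContinuousOn (prolateDefect F) U := by
  have c0 := hF.continuousOn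
  have h1 : ContDiffOn ℝ 1 (pd₁ F) U := contDiffOn_pd₁ hU hF one_add_one_eq_two.le
  have h2 : ContDiffOn ℝ 1 (pd₂ F) U := contDiffOn_pd₂ hU hF one_add_one_eq_two.le
  have c1 := h1.continuousOn
  have c2 := h2.continuousOn
  have c11 := (contDiffOn_pd₁ (m := 0) hU h1 (by simp)).continuousOn
  have c22 := (contDiffOn_pd₂ (m := 0) hU h2 (by simp)).continuousOn
  have cc : ContinuousOn (fun w => conj (F w)) U := Complex.continuous_conj.comp_continuousOn c0
  have x1 : ContinuousOn (fun w : ℝ × ℝ => (w.1 : ℂ)) U := by fun_prop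
  have x2 : ContinuousOn (fun w : ℝ × ℝ => (w.2 : ℂ)) U := by fun_prop
  unfold prolateDefect
  fun_prop

theorem prolate_equation_iff (hU : IsOpen U) {ξ : ℝ → ℝ → ℂ}
    (hF : ContDiffOn ℝ 2 (Function.uncurry ξ) U) {x y : ℝ} (hw : (x, y) ∈ U) :
    (ξ x y * conj (ξ x y) - 1) *
        (deriv (fun s : ℝ => ((s : ℂ) ^ 2 - 1) * deriv (fun t => ξ t y) s) x
          + deriv (fun s : ℝ => (1 - (s : ℂ) ^ 2) * deriv (fun t => ξ x t) s) y) =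
      2 * conj (ξ x y) *
        (((x : ℂ) ^ 2 - 1) * deriv (fun s => ξ s y) x ^ 2
          + (1 - (y : ℂ) ^ 2) * deriv (fun s => ξ x s) y ^ 2) ↔
    prolateDefect (Function.uncurry ξ) (x, y) = 0 := by
  have hx := deriv_deriv_comp_curve hU hF (X := fun s => s) (Y := fun _ => y) (X' := fun _ => 1)
    (Y' := fun _ => 0) (X'' := 0) (Y'' := 0) (t := x) hw (Eventually.of_forall hasDerivAt_id)
    (Eventually.of_forall fun s => hasDerivAt_const s y) (hasDerivAt_const _ _)
    (hasDerivAt_const _ _)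
  have hy := deriv_deriv_comp_curve hU hF (X := fun _ => x) (Y := fun s => s) (X' := fun _ => 0)
    (Y' := fun _ => 1) (X'' := 0) (Y'' := 0) (t := y) hw
    (Eventually.of_forall fun s => hasDerivAt_const s x) (Eventually.of_forall hasDerivAt_id)
    (hasDerivAt_const _ _) (hasDerivAt_const _ _)
  simp only [Complex.ofReal_zero, Complex.ofReal_one, zero_mul, one_mul, add_zero, zero_add,
    Function.uncurry_apply_pair] at hx hy
  have sq : ∀ t : ℝ, HasDerivAt (fun s : ℝ => (s : ℂ) ^ 2) (2 * (t : ℂ)) t := fun t => by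
    have := (hasDerivAt_pow 2 (t : ℂ)).comp_ofReal
    refine this.congr_deriv ?_
    norm_num
  have ex := (((sq x).sub_const 1).mul hx.2).deriv
  have ey := (((sq y).const_sub 1).mul hy.2).deriv
  have ex' : deriv (fun s : ℝ => ((s : ℂ) ^ 2 - 1) * deriv (fun t => ξ t y) s) x = _ := ex
  have ey' : deriv (fun s : ℝ => (1 - (s : ℂ) ^ 2) * deriv (fun t => ξ x t) s) y = _ := ey
  rw [ex', ey', hx.1, hy.1, ← sub_eq_zero]
  rfl

end Partial

end Ernst

namespace Ernst

open Matrix Filter Topology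

/-! ### The bordered determinant and the potential -/

/-- The matrix of Vein's determinant, over the reals. -/
noncomputable def borderedMatrix (n : ℕ) (p q x y z : ℝ) :
    Matrix (Fin n ⊕ Unit) (Fin n ⊕ Unit) ℝ :=
  Matrix.fromBlocks (hankel n p q x y) (Matrix.of fun i _ => prim n z i)
    (Matrix.of fun _ _ => (1 : ℝ)) 0

/-- Vein's determinant, over the reals. -/
noncomputable def bordered (n : ℕ) (p q x y z : ℝ) : ℝ := (borderedMatrix n p q x y z).det

theorem detVein_eq_bordered (n : ℕ) (p q x y z : ℝ) :
    detVein n x y p q z = (bordered n p q x y z : ℂ) := by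
  have h := RingHom.map_det Complex.ofRealHom (borderedMatrix n p q x y z)
  rw [Complex.ofRealHom_eq_coe] at h
  rw [bordered, h, detVein]
  congr 1
  ext (i | i) (j | j) <;> simp [borderedMatrix, hankel, moment, psi, prim]

theorem det_schur {n : ℕ} {A : Matrix (Fin n) (Fin n) ℝ} (hA : A.det ≠ 0) (u w : Fin n → ℝ) :
    (Matrix.fromBlocks A (Matrix.of fun i (_ : Unit) => w i) (Matrix.of fun (_ : Unit) i => u i)
      0).det = -(A.det * (u ⬝ᵥ A⁻¹ *ᵥ w)) := by
  have := Matrix.invertibleOfIsUnitDet A (isUnit_iff_ne_zero.2 hA)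
  rw [Matrix.det_fromBlocks₁₁, Matrix.det_unique (n := Unit), Matrix.invOf_eq_nonsing_inv,
    Matrix.mul_assoc, zero_sub, Matrix.neg_apply, mul_neg]
  rfl

theorem bordered_eq {n : ℕ} {p q x y : ℝ} (hA : (hankel n p q x y).det ≠ 0) (z : ℝ) :
    bordered n p q x y z = -((hankel n p q x y).det * gam n p q x y 1 z) := by
  have h := det_schur hA (mono n 1) (prim n z)
  rw [gam, bil, ← h, bordered, borderedMatrix]
  congr 2
  ext i j
  simp [mono]

theorem contDiff_bordered (n : ℕ) (p q : ℝ) {k : WithTop ℕ∞} {c : ℝ × ℝ → ℝ}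
    (hc : ContDiff ℝ k c) :
    ContDiff ℝ k fun w : ℝ × ℝ => bordered n p q w.1 w.2 (c w) := by
  refine contDiff_det (M := fun w : ℝ × ℝ => borderedMatrix n p q w.1 w.2 (c w)) ?_
  rintro (i | i) (j | j)
  · exact contDiff_moment p q ((i : ℕ) + (j : ℕ))
  · exact (hc.pow _).div_const _
  · exact contDiff_const
  · exact contDiff_const

theorem detS_one_eq_bordered {p q : ℝ} (hpq : p ^ 2 + q ^ 2 = 1) (n : ℕ) (x y : ℝ) (h : ℂ) :
    detS n x y p q h 1 = (bordered n p q x y 1 : ℂ) := by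
  have h1 := mul_detS_zero n x y p q 1
  rw [detS_eq_detS_zero hpq, ← detVein_eq_bordered, Complex.ofReal_one, ← h1, one_mul]

theorem potential_eq {p q : ℝ} (hpq : p ^ 2 + q ^ 2 = 1) (n : ℕ) (h : ℝ → ℝ → ℝ → ℝ → ℂ)
    (x y : ℝ) : potential n p q h x y = (((p * bordered n p q x y x : ℝ) : ℂ) -
      Complex.I * ((q * bordered n p q x y y : ℝ) : ℂ)) / (bordered n p q x y 1 : ℂ) := by
  have h1 := mul_detS_zero n x y p q x
  have h2 := mul_detS_zero n x y p q y
  rw [detVein_eq_bordered] at h1 h2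
  rw [potential, detS_one_eq_bordered hpq, detS_eq_detS_zero hpq _ _ _ _ (x : ℂ),
    detS_eq_detS_zero hpq _ _ _ _ (y : ℂ)]
  push_cast
  rw [← h1, ← h2]
  ring

theorem potential_eq_kernelPotential {n : ℕ} {p q x y : ℝ} (hpq : p ^ 2 + q ^ 2 = 1)
    (h : ℝ → ℝ → ℝ → ℝ → ℂ) (hA : (hankel n p q x y).det ≠ 0) :
    potential n p q h x y = kernelPotential n p q x y := by
  have hA' : ((hankel n p q x y).det : ℂ) ≠ 0 := by exact_mod_cast hA
  rw [potential_eq hpq, kernelPotential, bordered_eq hA, bordered_eq hA, bordered_eq hA]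
  rw [← mul_div_mul_left _ ((gam n p q x y 1 1 : ℝ) : ℂ) (neg_ne_zero.2 hA')]
  congr 1 <;> push_cast <;> ring

theorem contDiffOn_potential {p q : ℝ} (hpq : p ^ 2 + q ^ 2 = 1) (n : ℕ)
    (h : ℝ → ℝ → ℝ → ℝ → ℂ) : ContDiffOn ℝ 2 (Function.uncurry (potential n p q h))
      {w | bordered n p q w.1 w.2 1 ≠ 0} := by
  have e : Function.uncurry (potential n p q h) = fun w : ℝ × ℝ =>
      (((p * bordered n p q w.1 w.2 w.1 : ℝ) : ℂ) -
      Complex.I * ((q * bordered n p q w.1 w.2 w.2 : ℝ) : ℂ)) /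
        (bordered n p q w.1 w.2 1 : ℂ) := by
    ext w; exact potential_eq hpq n h w.1 w.2
  rw [e]
  have c : ∀ {f : ℝ × ℝ → ℝ}, ContDiff ℝ 2 f → ContDiff ℝ 2 fun w => (f w : ℂ) :=
    fun hf => Complex.ofRealCLM.contDiff.comp hf
  have hN : ContDiff ℝ 2 fun w : ℝ × ℝ => (((p * bordered n p q w.1 w.2 w.1 : ℝ) : ℂ) -
      Complex.I * ((q * bordered n p q w.1 w.2 w.2 : ℝ) : ℂ)) :=
    (c (contDiff_const.mul (contDiff_bordered n p q contDiff_fst))).sub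
      (contDiff_const.mul (c (contDiff_const.mul (contDiff_bordered n p q contDiff_snd))))
  have hD : ContDiff ℝ 2 fun w : ℝ × ℝ => (bordered n p q w.1 w.2 1 : ℂ) :=
    c (contDiff_bordered n p q contDiff_const)
  simp only [div_eq_mul_inv]
  exact hN.contDiffOn.mul (hD.contDiffOn.inv fun w hw => Complex.ofReal_ne_zero.2 hw)

/-! ### Generic nonvanishing -/

/-- The Hilbert matrix of order `n`. -/
noncomputable def hilbert (n : ℕ) : Matrix (Fin n) (Fin n) ℝ :=
  Matrix.of fun i j => 1 / (((i : ℕ) : ℝ) + ((j : ℕ) : ℝ) + 1)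

/-- The Hilbert matrix is the Gram matrix of the monomials in `L²[0, 1]`. -/
theorem hilbert_posDef (n : ℕ) : (hilbert n).PosDef := by
  refine Matrix.PosDef.of_dotProduct_mulVec_pos ?_ fun c hc => ?_
  · ext i j; simp [hilbert, add_comm]
  set f : ℝ → ℝ := fun t => ∑ i : Fin n, c i * t ^ (i : ℕ) with hf
  have hfc : Continuous f := by fun_prop
  have hint : star c ⬝ᵥ hilbert n *ᵥ c = ∫ t in (0 : ℝ)..1, f t ^ 2 := by
    have e : ∀ t, f t ^ 2 = ∑ i : Fin n, ∑ j : Fin n, (c i * c j) * t ^ ((i : ℕ) + (j : ℕ)) := by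
      intro t
      rw [hf, sq, Finset.sum_mul_sum]
      exact Finset.sum_congr rfl fun i _ => Finset.sum_congr rfl fun j _ => by ring
    simp only [e]
    rw [intervalIntegral.integral_finsetSum
      fun i _ => Continuous.intervalIntegrable (by fun_prop) _ _]
    simp only [dotProduct, Matrix.mulVec, star_trivial, Finset.mul_sum]
    refine Finset.sum_congr rfl fun i _ => ?_
    rw [intervalIntegral.integral_finsetSum
      fun j _ => Continuous.intervalIntegrable (by fun_prop) _ _]
    refine Finset.sum_congr rfl fun j _ => ?_
    rw [intervalIntegral.integral_const_mul, integral_pow]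
    simp [hilbert]
    ring
  rw [hint]
  refine intervalIntegral.integral_pos one_pos (hfc.pow 2).continuousOn
    (fun t _ => sq_nonneg _) ?_
  by_contra! hcon
  -- a polynomial of degree `< n` vanishing at `n` points of `[0, 1]` is zero
  refine hc (Matrix.eq_zero_of_forall_index_sum_mul_pow_eq_zero
    (f := fun j : Fin n => ((j : ℕ) : ℝ) / n) (v := c) ?_ fun j => ?_)
  · intro i j hij
    have hn : (n : ℝ) ≠ 0 := by exact_mod_cast (Fin.pos i).ne'
    have : ((i : ℕ) : ℝ) = ((j : ℕ) : ℝ) := by simpa [hn] using hij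
    exact Fin.ext (by exact_mod_cast this)
  · have hn : (0 : ℝ) < n := by exact_mod_cast Fin.pos j
    have hj : ((j : ℕ) : ℝ) ≤ n := by exact_mod_cast j.2.le
    have := hcon (((j : ℕ) : ℝ) / n) ⟨by positivity, (div_le_one hn).2 hj⟩
    exact pow_eq_zero_iff two_ne_zero |>.1 (le_antisymm this (sq_nonneg _))

/-- The moment matrix on the diagonal `x = y = 1 / d`, rescaled to have a limit as `d → 0`. -/
noncomputable def scaledHankel (n : ℕ) (d : ℝ) : Matrix (Fin n) (Fin n) ℝ :=
  Matrix.of fun i j => (1 - d ^ (2 * ((i : ℕ) + (j : ℕ) + 1))) /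
    (((i : ℕ) : ℝ) + ((j : ℕ) : ℝ) + 1)

/-- The bordered matrix with `z = 1` on the diagonal `x = y = 1 / d`, rescaled likewise. -/
noncomputable def scaledBordered (n : ℕ) (d : ℝ) : Matrix (Fin n ⊕ Unit) (Fin n ⊕ Unit) ℝ :=
  Matrix.fromBlocks (scaledHankel n d)
    (Matrix.of fun i _ => d ^ (2 * (i : ℕ)) / (2 * ((i : ℕ) : ℝ) + 1))
    (Matrix.of fun _ j => d ^ (2 * (j : ℕ))) 0

theorem hankel_diagonal_eq {p q d : ℝ} (hpq : p ^ 2 + q ^ 2 = 1) (hd : d ≠ 0) (n : ℕ) :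
    hankel n p q (1 / d) (1 / d) =
      Matrix.diagonal (fun i : Fin n => (1 / d) ^ (2 * (i : ℕ) + 2)) * scaledHankel n d *
        Matrix.diagonal (fun i : Fin n => (1 / d) ^ (2 * (i : ℕ))) := by
  ext i j
  have h3 : ((i : ℕ) : ℝ) + ((j : ℕ) : ℝ) + 1 ≠ 0 := by positivity
  rw [Matrix.mul_diagonal, Matrix.diagonal_mul]
  simp only [hankel, scaledHankel, moment, Matrix.of_apply]
  rw [← add_mul, hpq, one_mul]
  push_cast
  rw [← pow_mul, div_pow, div_pow, div_pow]
  field_simp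
  ring

theorem borderedMatrix_diagonal_eq {p q d : ℝ} (hpq : p ^ 2 + q ^ 2 = 1) (hd : d ≠ 0) (n : ℕ) :
    borderedMatrix n p q (1 / d) (1 / d) 1 =
      Matrix.fromBlocks (Matrix.diagonal fun i : Fin n => (1 / d) ^ (2 * (i : ℕ) + 2)) 0 0
          (1 : Matrix Unit Unit ℝ) * scaledBordered n d *
        Matrix.fromBlocks (Matrix.diagonal fun i : Fin n => (1 / d) ^ (2 * (i : ℕ))) 0 0
          (Matrix.diagonal fun _ : Unit => d ^ 2) := by
  rw [borderedMatrix, scaledBordered, Matrix.fromBlocks_multiply, Matrix.fromBlocks_multiply,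
    hankel_diagonal_eq hpq hd]
  congr 1
  · simp
  · ext i j
    have h1 : 2 * ((i : ℕ) : ℝ) + 1 ≠ 0 := by positivity
    simp [prim]
    field_simp
    ring
  · ext i j
    simp [hd]
  · simp

/-- At `d = 0` the rescaled determinants are those of the Hilbert matrix `H` and, up to sign,
`det H · (H⁻¹)₀₀`, both positive; they stay nonzero for small `d`. -/
theorem exists_hankel_and_bordered_ne_zero {n : ℕ} (hn : 1 ≤ n) {p q : ℝ}
    (hpq : p ^ 2 + q ^ 2 = 1) :
    ∃ x : ℝ, (hankel n p q x x).det ≠ 0 ∧ bordered n p q x x 1 ≠ 0 := by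
  have h0 : scaledHankel n 0 = hilbert n := by
    ext i j; simp [scaledHankel, hilbert]
  have hH : (scaledHankel n 0).det ≠ 0 := by rw [h0]; exact (hilbert_posDef n).det_pos.ne'
  have hB : (scaledBordered n 0).det ≠ 0 := by
    let k : Fin n := ⟨0, hn⟩
    have e : scaledBordered n 0 = Matrix.fromBlocks (hilbert n)
        (Matrix.of fun i (_ : Unit) => (Pi.single k 1 : Fin n → ℝ) i)
        (Matrix.of fun (_ : Unit) i => (Pi.single k 1 : Fin n → ℝ) i) 0 := by
      rw [scaledBordered, h0]
      have hk : ∀ i : Fin n, i = k ↔ (i : ℕ) = 0 := fun i => Fin.ext_iff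
      congr 1
      · ext i j
        by_cases hi : (i : ℕ) = 0 <;> simp [Pi.single_apply, hk, hi]
      · ext i j
        by_cases hi : (j : ℕ) = 0 <;> simp [Pi.single_apply, hk, hi]
    rw [e, det_schur (hilbert_posDef n).det_pos.ne']
    have hpos := (hilbert_posDef n).inv.diag_pos (i := k)
    simp only [Matrix.mulVec_single_one, single_one_dotProduct, Matrix.col_apply]
    exact neg_ne_zero.2 (mul_ne_zero (hilbert_posDef n).det_pos.ne' hpos.ne')
  have cH : Continuous fun d => (scaledHankel n d).det :=
    Continuous.matrix_det (continuous_matrix fun i j => by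
      simp only [scaledHankel, Matrix.of_apply]; fun_prop)
  have cB : Continuous fun d => (scaledBordered n d).det :=
    Continuous.matrix_det (continuous_matrix fun i j => by
      rcases i with i | i <;> rcases j with j | j <;>
        simp only [scaledBordered, scaledHankel, Matrix.fromBlocks_apply₁₁,
          Matrix.fromBlocks_apply₁₂, Matrix.fromBlocks_apply₂₁, Matrix.fromBlocks_apply₂₂,
          Matrix.of_apply, Matrix.zero_apply] <;> fun_prop)
  have ev : ∀ᶠ d in 𝓝[≠] (0 : ℝ), (scaledHankel n d).det ≠ 0 ∧ (scaledBordered n d).det ≠ 0 :=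
    ((cH.continuousAt.eventually_ne hH).and (cB.continuousAt.eventually_ne hB)).filter_mono
      nhdsWithin_le_nhds
  obtain ⟨d, ⟨h1, h2⟩, hd⟩ := (ev.and self_mem_nhdsWithin).exists
  have hd : d ≠ 0 := hd
  have hprod : ∀ f : Fin n → ℕ, ∏ i, (1 / d) ^ f i ≠ 0 := fun f =>
    Finset.prod_ne_zero_iff.2 fun i _ => pow_ne_zero _ (one_div_ne_zero hd)
  refine ⟨1 / d, ?_, ?_⟩
  · rw [hankel_diagonal_eq hpq hd, Matrix.det_mul, Matrix.det_mul, Matrix.det_diagonal,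
      Matrix.det_diagonal]
    exact mul_ne_zero (mul_ne_zero (hprod _) h1) (hprod _)
  · rw [bordered, borderedMatrix_diagonal_eq hpq hd, Matrix.det_mul, Matrix.det_mul,
      Matrix.det_fromBlocks_zero₂₁, Matrix.det_fromBlocks_zero₂₁, Matrix.det_diagonal,
      Matrix.det_diagonal, Matrix.det_one, Matrix.det_diagonal]
    refine mul_ne_zero (mul_ne_zero (mul_ne_zero (hprod _) one_ne_zero) h2)
      (mul_ne_zero (hprod _) ?_)
    simp [hd]

theorem dense_ne_zero_of_analytic {f : ℝ × ℝ → ℝ} (hf : ContDiff ℝ ⊤ f) {w₀ : ℝ × ℝ}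
    (h₀ : f w₀ ≠ 0) : Dense {w | f w ≠ 0} := by
  have ha : AnalyticOnNhd ℝ f Set.univ := contDiff_omega_iff_analyticOnNhd.1 hf
  rw [← compl_compl {w | f w ≠ 0}, ← interior_eq_empty_iff_dense_compl,
    Set.eq_empty_iff_forall_notMem]
  intro w hw
  refine h₀ (ha.eqOn_zero_of_preconnected_of_eventuallyEq_zero isPreconnected_univ
    (Set.mem_univ w) ?_ (Set.mem_univ w₀))
  filter_upwards [mem_interior_iff_mem_nhds.1 hw] with v hv
  simpa using hv

theorem dense_hankel_and_bordered_ne_zero {n : ℕ} (hn : 1 ≤ n) {p q : ℝ}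
    (hpq : p ^ 2 + q ^ 2 = 1) : Dense {w : ℝ × ℝ |
      (hankel n p q w.1 w.2).det ≠ 0 ∧ bordered n p q w.1 w.2 1 ≠ 0} := by
  obtain ⟨x, h1, h2⟩ := exists_hankel_and_bordered_ne_zero hn hpq
  have := dense_ne_zero_of_analytic (w₀ := (x, x))
    ((contDiff_det_hankel n p q).mul (contDiff_bordered n p q (c := fun _ => 1) contDiff_const))
    (mul_ne_zero h1 h2)
  simpa only [mul_ne_zero_iff] using this

/-! ### The Ernst equation in prolate coordinates -/

/-- The equation extends from the points with invertible moment matrix by continuity, these points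
being dense. -/
theorem isProlateSolutionOn_potential {n : ℕ} (hn : 1 ≤ n) {p q : ℝ} (hpq : p ^ 2 + q ^ 2 = 1)
    (h : ℝ → ℝ → ℝ → ℝ → ℂ) :
    IsProlateSolutionOn {w | bordered n p q w.1 w.2 1 ≠ 0} (potential n p q h) := by
  set U : Set (ℝ × ℝ) := {w | bordered n p q w.1 w.2 1 ≠ 0} with hUdef
  have hU : IsOpen U := isOpen_ne_fun
    (contDiff_bordered n p q (k := 0) (c := fun _ => 1) contDiff_const).continuous continuous_const
  have hF := contDiffOn_potential hpq n h
  refine ⟨hU, hF, fun x y hw => (prolate_equation_iff hU hF hw).2 ?_⟩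
  set W : Set (ℝ × ℝ) := {w | (hankel n p q w.1 w.2).det ≠ 0 ∧ bordered n p q w.1 w.2 1 ≠ 0}
    with hWdef
  have hWU : W ⊆ U := fun w hw => hw.2
  have hzero : Set.EqOn (prolateDefect (Function.uncurry (potential n p q h))) (fun _ => 0) W := by
    rintro ⟨a, b⟩ hab
    have hdet : (hankel n p q a b).det ≠ 0 := hab.1
    refine (prolate_equation_iff hU hF (hWU hab)).1
      (prolate_equation_of_det_ne_zero hpq hdet ?_ ?_)
    · have h2 : bordered n p q a b 1 ≠ 0 := hab.2
      rw [bordered_eq hdet] at h2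
      exact (mul_ne_zero_iff.1 (neg_ne_zero.1 h2)).2
    · filter_upwards [(contDiff_det_hankel n p q (k := 0)).continuous.continuousAt.eventually_ne
        (x := (a, b)) hdet] with w hw
      exact potential_eq_kernelPotential hpq h hw
  exact Set.EqOn.of_subset_closure hzero (continuousOn_prolateDefect hU hF) continuousOn_const hWU
    (fun w _ => dense_hankel_and_bordered_ne_zero hn hpq w) hw

end Ernst

namespace Ernst

open Filter Topology

/-! ### Cylindrical coordinates -/

theorem hasDerivAt_sqrt_sq_add {f : ℝ → ℝ} {f' g t : ℝ} (hf : HasDerivAt f f' t)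
    (h : 0 < g + f t ^ 2) :
    HasDerivAt (fun s => √(g + f s ^ 2)) (f' * f t / √(g + f t ^ 2)) t := by
  refine (((hf.pow 2).const_add g).sqrt h.ne').congr_deriv ?_
  simp
  ring

/-- The function `s ↦ (s + c) / √(g + (s + c)²)` is the derivative of the distance. -/
theorem hasDerivAt_div_sqrt {g c t : ℝ} (h : 0 < g + (t + c) ^ 2) :
    HasDerivAt (fun s => (s + c) / √(g + (s + c) ^ 2))
      (1 / √(g + (t + c) ^ 2) - (t + c) ^ 2 / √(g + (t + c) ^ 2) ^ 3) t := by
  have hs : √(g + (t + c) ^ 2) ≠ 0 := (Real.sqrt_pos.2 h).ne'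
  have hl : HasDerivAt (fun s : ℝ => s + c) 1 t := (hasDerivAt_id t).add_const c
  refine (hl.div (hasDerivAt_sqrt_sq_add hl h) hs).congr_deriv ?_
  field_simp

theorem continuous_prolate (κ : ℝ) :
    Continuous fun w : ℝ × ℝ => (prolateX κ w.1 w.2, prolateY κ w.1 w.2) := by
  unfold prolateX prolateY
  fun_prop

theorem contDiffOn_prolate (κ : ℝ) {k : WithTop ℕ∞} : ContDiffOn ℝ k
    (fun w : ℝ × ℝ => (prolateX κ w.1 w.2, prolateY κ w.1 w.2)) {w | 0 < w.1} := by
  have h : ∀ c : ℝ, ContDiffOn ℝ k (fun w : ℝ × ℝ => √(w.1 ^ 2 + (w.2 + c) ^ 2)) {w | 0 < w.1} :=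
    fun c => ContDiffOn.sqrt (by fun_prop) fun w hw => by
      have : 0 < w.1 := hw
      positivity
  have h1 := h κ
  have h2 := h (-κ)
  simp only [← sub_eq_add_neg] at h2
  exact ((h1.add h2).div_const _).prodMk ((h1.sub h2).div_const _)

/-- A solution of the prolate equation, read in cylindrical coordinates, solves the Ernst equation:
the prolate coordinates are orthogonal, `|∇x|² = (x² - 1) / (ab)`, `|∇y|² = (1 - y²) / (ab)`,
`∇²x = 2x / (ab)`, `∇²y = -2y / (ab)`, where `a` and `b` are the distances from the two foci. -/
theorem IsProlateSolutionOn.isSolutionOn {U : Set (ℝ × ℝ)} {ξ : ℝ → ℝ → ℂ}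
    (h : IsProlateSolutionOn U ξ) {κ : ℝ} (hκ : 0 < κ) :
    IsSolutionOn {w | 0 < w.1 ∧ (prolateX κ w.1 w.2, prolateY κ w.1 w.2) ∈ U}
      (fun r z => ξ (prolateX κ r z) (prolateY κ r z)) := by
  obtain ⟨hU, hF, heq⟩ := h
  refine ⟨(isOpen_lt continuous_const continuous_fst).inter
    (hU.preimage (continuous_prolate κ)), ?_, ?_⟩
  · exact hF.comp ((contDiffOn_prolate κ).mono fun w hw => hw.1) fun w hw => hw.2
  rintro r z ⟨hr, hw⟩
  change 0 < r at hr
  change (prolateX κ r z, prolateY κ r z) ∈ U at hw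
  have hE := (prolate_equation_iff hU hF hw).1 (heq _ _ hw)
  have hpos : ∀ s c : ℝ, 0 < s → 0 < c ^ 2 + (s + 0) ^ 2 := fun s c hs => by positivity
  have hpos' : ∀ s c : ℝ, 0 < r ^ 2 + (s + c) ^ 2 := fun s c => by positivity
  have hev : ∀ᶠ s in 𝓝 r, 0 < s := lt_mem_nhds hr
  set a := √(r ^ 2 + (z + κ) ^ 2) with ha
  set b := √(r ^ 2 + (z - κ) ^ 2) with hb
  have ha0 : 0 < a := Real.sqrt_pos.2 (by positivity)
  have hb0 : 0 < b := Real.sqrt_pos.2 (by positivity)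
  have ha2 : a ^ 2 = r ^ 2 + (z + κ) ^ 2 := Real.sq_sqrt (by positivity)
  have hb2 : b ^ 2 = r ^ 2 + (z - κ) ^ 2 := Real.sq_sqrt (by positivity)
  -- the distances as functions of `r` and of `z`
  have ar : ∀ c s : ℝ, 0 < s → HasDerivAt (fun s => √(s ^ 2 + c ^ 2)) (s / √(s ^ 2 + c ^ 2)) s := by
    intro c s hs
    have h := hasDerivAt_sqrt_sq_add (g := c ^ 2) (hasDerivAt_id s) (by simp; positivity)
    simpa [add_comm] using h
  have arr : ∀ c : ℝ, HasDerivAt (fun s => s / √(s ^ 2 + c ^ 2))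
      (1 / √(r ^ 2 + c ^ 2) - r ^ 2 / √(r ^ 2 + c ^ 2) ^ 3) r := by
    intro c
    have h := hasDerivAt_div_sqrt (hpos r c hr)
    simpa [add_comm] using h
  have az : ∀ c s : ℝ, HasDerivAt (fun s => √(r ^ 2 + (s + c) ^ 2))
      ((s + c) / √(r ^ 2 + (s + c) ^ 2)) s := by
    intro c s
    have h := hasDerivAt_sqrt_sq_add (g := r ^ 2) ((hasDerivAt_id s).add_const c) (hpos' s c)
    simpa using h
  have azz := fun c : ℝ => hasDerivAt_div_sqrt (hpos' z c)
  have hR := deriv_deriv_comp_curve hU hF (t := r)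
    (X := fun s => prolateX κ s z) (Y := fun s => prolateY κ s z)
    (X' := fun s => (s / √(s ^ 2 + (z + κ) ^ 2) + s / √(s ^ 2 + (z - κ) ^ 2)) / (2 * κ))
    (Y' := fun s => (s / √(s ^ 2 + (z + κ) ^ 2) - s / √(s ^ 2 + (z - κ) ^ 2)) / (2 * κ)) hw
    (hev.mono fun s hs => ((ar _ s hs).add (ar _ s hs)).div_const _)
    (hev.mono fun s hs => ((ar _ s hs).sub (ar _ s hs)).div_const _)
    (((arr _).add (arr _)).div_const _) (((arr _).sub (arr _)).div_const _)
  have hZ := deriv_deriv_comp_curve hU hF (t := z)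
    (X := fun s => prolateX κ r s) (Y := fun s => prolateY κ r s)
    (X' := fun s => ((s + κ) / √(r ^ 2 + (s + κ) ^ 2)
      + (s + -κ) / √(r ^ 2 + (s + -κ) ^ 2)) / (2 * κ))
    (Y' := fun s => ((s + κ) / √(r ^ 2 + (s + κ) ^ 2)
      - (s + -κ) / √(r ^ 2 + (s + -κ) ^ 2)) / (2 * κ)) hw
    (Eventually.of_forall fun s => ((az κ s).add (az (-κ) s)).div_const _)
    (Eventually.of_forall fun s => ((az κ s).sub (az (-κ) s)).div_const _)
    (((azz κ).add (azz (-κ))).div_const _) (((azz κ).sub (azz (-κ))).div_const _)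
  simp only [Function.uncurry_apply_pair, ← sub_eq_add_neg] at hR hZ
  have hX : prolateX κ r z = (a + b) / (2 * κ) := rfl
  have hY : prolateY κ r z = (a - b) / (2 * κ) := rfl
  beta_reduce
  rw [hR.1, hR.2.deriv, hZ.1, hZ.2.deriv]
  unfold prolateDefect at hE
  simp only [Function.uncurry_apply_pair] at hE
  rw [← ha, ← hb, hX, hY]
  rw [hX, hY] at hE
  clear hR hZ ar arr az azz hev hpos hpos' hX hY heq
  -- the metric identities of prolate coordinates
  have i₁ : ((r / a + r / b) / (2 * κ)) ^ 2 + (((z + κ) / a + (z - κ) / b) / (2 * κ)) ^ 2 =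
      (((a + b) / (2 * κ)) ^ 2 - 1) * (1 / (a * b)) := by
    have e : r ^ 2 + z ^ 2 - κ ^ 2 = (a ^ 2 + b ^ 2) / 2 - 2 * κ ^ 2 := by
      linear_combination (-1 / 2 : ℝ) * ha2 - (1 / 2) * hb2
    field_simp
    linear_combination (-b ^ 2) * ha2 - a ^ 2 * hb2 + 2 * a * b * e
  have i₂ : ((r / a - r / b) / (2 * κ)) ^ 2 + (((z + κ) / a - (z - κ) / b) / (2 * κ)) ^ 2 =
      (1 - ((a - b) / (2 * κ)) ^ 2) * (1 / (a * b)) := by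
    have e : r ^ 2 + z ^ 2 - κ ^ 2 = (a ^ 2 + b ^ 2) / 2 - 2 * κ ^ 2 := by
      linear_combination (-1 / 2 : ℝ) * ha2 - (1 / 2) * hb2
    field_simp
    linear_combination (-b ^ 2) * ha2 - a ^ 2 * hb2 - 2 * a * b * e
  have i₃ : (r / a + r / b) / (2 * κ) * ((r / a - r / b) / (2 * κ)) +
      ((z + κ) / a + (z - κ) / b) / (2 * κ) * (((z + κ) / a - (z - κ) / b) / (2 * κ)) = 0 := by
    field_simp
    linear_combination (-b ^ 2) * ha2 + a ^ 2 * hb2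
  have hr0 := hr.ne'
  have i₄ : (1 / a - r ^ 2 / a ^ 3 + (1 / b - r ^ 2 / b ^ 3)) / (2 * κ) +
      1 / r * ((r / a + r / b) / (2 * κ)) +
      (1 / a - (z + κ) ^ 2 / a ^ 3 + (1 / b - (z - κ) ^ 2 / b ^ 3)) / (2 * κ) =
      2 * ((a + b) / (2 * κ)) * (1 / (a * b)) := by
    field_simp
    linear_combination (b ^ 3) * ha2 + a ^ 3 * hb2
  have i₅ : (1 / a - r ^ 2 / a ^ 3 - (1 / b - r ^ 2 / b ^ 3)) / (2 * κ) +
      1 / r * ((r / a - r / b) / (2 * κ)) +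
      (1 / a - (z + κ) ^ 2 / a ^ 3 - (1 / b - (z - κ) ^ 2 / b ^ 3)) / (2 * κ) =
      -(2 * ((a - b) / (2 * κ))) * (1 / (a * b)) := by
    field_simp
    linear_combination (b ^ 3) * ha2 - a ^ 3 * hb2
  generalize (a + b) / (2 * κ) = x at *
  generalize (a - b) / (2 * κ) = y at *
  generalize (r / a + r / b) / (2 * κ) = x₁ at *
  generalize (r / a - r / b) / (2 * κ) = y₁ at *
  generalize ((z + κ) / a + (z - κ) / b) / (2 * κ) = x₂ at *
  generalize ((z + κ) / a - (z - κ) / b) / (2 * κ) = y₂ at *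
  generalize (1 / a - r ^ 2 / a ^ 3 + (1 / b - r ^ 2 / b ^ 3)) / (2 * κ) = x₁₁ at *
  generalize (1 / a - r ^ 2 / a ^ 3 - (1 / b - r ^ 2 / b ^ 3)) / (2 * κ) = y₁₁ at *
  generalize (1 / a - (z + κ) ^ 2 / a ^ 3 + (1 / b - (z - κ) ^ 2 / b ^ 3)) / (2 * κ) = x₂₂ at *
  generalize (1 / a - (z + κ) ^ 2 / a ^ 3 - (1 / b - (z - κ) ^ 2 / b ^ 3)) / (2 * κ) = y₂₂ at *
  generalize 1 / (a * b) = c at *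
  replace i₁ := congrArg (fun r : ℝ => (r : ℂ)) i₁
  replace i₂ := congrArg (fun r : ℝ => (r : ℂ)) i₂
  replace i₃ := congrArg (fun r : ℝ => (r : ℂ)) i₃
  replace i₄ := congrArg (fun r : ℝ => (r : ℂ)) i₄
  replace i₅ := congrArg (fun r : ℝ => (r : ℂ)) i₅
  push_cast at i₁ i₂ i₃ i₄ i₅
  generalize pd₁ (pd₁ (Function.uncurry ξ)) (x, y) = F₁₁ at *
  generalize pd₂ (pd₁ (Function.uncurry ξ)) (x, y) = F₁₂ at *
  generalize pd₁ (pd₂ (Function.uncurry ξ)) (x, y) = F₂₁ at *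
  generalize pd₂ (pd₂ (Function.uncurry ξ)) (x, y) = F₂₂ at *
  generalize pd₁ (Function.uncurry ξ) (x, y) = F₁ at *
  generalize pd₂ (Function.uncurry ξ) (x, y) = F₂ at *
  generalize conj (ξ x y) = G at *
  generalize ξ x y = F at *
  linear_combination (c : ℂ) * hE + ((F * G - 1) * F₁₁ - 2 * G * F₁ ^ 2) * i₁
    + ((F * G - 1) * F₂₂ - 2 * G * F₂ ^ 2) * i₂
    + ((F * G - 1) * (F₁₂ + F₂₁) - 4 * G * F₁ * F₂) * i₃
    + (F * G - 1) * F₁ * i₄ + (F * G - 1) * F₂ * i₅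

end Ernst

theorem mainTheorem1 (n : ℕ) (hn : 1 ≤ n) (p q : ℝ) (hpq : p ^ 2 + q ^ 2 = 1)
    (h : ℝ → ℝ → ℝ → ℝ → ℂ) :
    -- the determinant is, for every `h`, that of Vein and that of Yamazaki and Hori
    (∀ (x y : ℝ) (z : ℂ),
      z * Ernst.detS n x y p q (h x y p q) z = Ernst.detVein n x y p q z ∧
      Ernst.detS n x y p q (h x y p q) z = -Ernst.detYH n x y p q z) ∧
    -- the denominator vanishes only on a set with empty interior
    Dense {w : ℝ × ℝ | Ernst.detS n w.1 w.2 p q (h w.1 w.2 p q) 1 ≠ 0} ∧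
    -- the potential solves the Ernst equation, in prolate spheroidal coordinates
    Ernst.IsProlateSolutionOn
      {w : ℝ × ℝ | Ernst.detS n w.1 w.2 p q (h w.1 w.2 p q) 1 ≠ 0}
      (Ernst.potential n p q h) ∧
    -- and as a function of the cylindrical coordinates
    ∀ κ : ℝ, 0 < κ →
      Ernst.IsSolutionOn
        {w : ℝ × ℝ | 0 < w.1 ∧
          Ernst.detS n (Ernst.prolateX κ w.1 w.2) (Ernst.prolateY κ w.1 w.2) p q
            (h (Ernst.prolateX κ w.1 w.2) (Ernst.prolateY κ w.1 w.2) p q) 1 ≠ 0}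
        (fun r z => Ernst.potential n p q h (Ernst.prolateX κ r z) (Ernst.prolateY κ r z)) := by
  have hset : ∀ x y : ℝ,
      Ernst.detS n x y p q (h x y p q) 1 ≠ 0 ↔ Ernst.bordered n p q x y 1 ≠ 0 := fun x y => by
    rw [Ernst.detS_one_eq_bordered hpq, Complex.ofReal_ne_zero]
  simp only [hset]
  have hsol := Ernst.isProlateSolutionOn_potential hn hpq h
  refine ⟨fun x y z => ⟨?_, ?_⟩, ?_, hsol, fun κ hκ => hsol.isSolutionOn hκ⟩
  · rw [Ernst.detS_eq_detS_zero hpq, Ernst.mul_detS_zero]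
  · rw [Ernst.detS_eq_detS_zero hpq, ← Ernst.detS_eq_detS_zero hpq n x y 1, Ernst.detS_one_eq n hn]
  · exact (Ernst.dense_hankel_and_bordered_ne_zero hn hpq).mono fun w hw => hw.2
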